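/- Let $H_n=\mathbb C^n\times\mathbb R$ be the Heisenberg group with coordinates $(z,t)$, $z=x+iy$, contact form $\Theta=dt+\sum_\beta (x_\beta\,dy_\beta-y_\beta\,dx_\beta)$, contact bundle $\xi=\ker\Theta$, CR structure $J$ on $\xi$ given by $J\mathring e_\beta=\mathring e_{n+\beta}$, $J\mathring e_{n+\beta}=-\mathring e_\beta$, where $\mathring e_\beta=\partial_{x_\beta}+y_\beta\partial_t$ and $\mathring e_{n+\beta}=\partial_{y_\beta}-x_\beta\partial_t$, the metric on $\xi$ making these vector fields orthonormal, and Reeb field $T=\partial_t$. A pseudohermitian manifold is a smooth manifold with a smooth contact form $\hat\theta$ and a smooth integrable complex structure $\hat J$ on $\hat\xi=\ker\hat\theta$ such that $d\hat\theta(X,\hat JX)>0$ for $0\ne X\in\hat\xi$. A pseudohermitian transformation is a diffeomorphism $\varphi$ between such manifolds that preserves the contact forms ($\varphi^*\tilde\theta=\hat\theta$) and satisfies $\varphi_*\circ\hat J=\tilde J\circ\varphi_*$ on $\hat\xi$; a Heisenberg rigid motion is a pseudohermitian transformation of $H_n$ onto itself. A pseudohermitian submanifold of $H_n$ of CR dimension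 $m$ is an (immersed, e.g. embedded) submanifold $M$ that is a pseudohermitian manifold $(M,\hat J,\hat\theta)$ of dimension $2m+1$ with $\hat\theta=\Theta|_M$, $\hat\xi=TM\cap\xi$ and $\hat J=J|_{\hat\xi}$. Its fundamental vector field $\nu$ is the unique section over $M$ of the orthogonal complement of $\hat\xi$ in $\xi$ such that $T+\nu$ is tangent to $M$. Let $n\ge 2$ and let $(M,\hat J,\hat\theta)$ and $(N,\tilde J,\tilde\theta)$ be two simply connected pseudohermitian submanifolds of $H_n$ of CR dimension $m=n-1$, whose fundamental vector fields vanish nowhere. Then the induced pseudohermitian structure is a complete invariant: a diffeomorphism $\phi:M\to N$ is a pseudohermitian transformation if and only if $\phi=\Phi|_M$ for some Heisenberg rigid motion $\Phi$ of $H_n$. -/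

import Mathlib

open scoped Manifold ContDiff

noncomputable section

/-! ### Pseudohermitian manifolds -/

section Pseudohermitian

variable {E : Type*} [NormedAddCommGroup E] [NormedSpace ℝ E]
  {H : Type*} [TopologicalSpace H] (I : ModelWithCorners ℝ E H)
  {M : Type*} [TopologicalSpace M] [ChartedSpace H M] [IsManifold I ∞ M]

/-- `X` is a smooth vector field on `U`. -/
def SmoothFieldOn (X : ∀ x : M, TangentSpace I x) (U : Set M) : Prop :=
  ContMDiffOn I I.tangent ∞ (fun x => (⟨x, X x⟩ : TangentBundle I M)) U

variable (M) in
/-- A (strictly pseudoconvex) pseudohermitian structure on `M`: a smooth contact form `θ` and a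
smooth integrable complex structure `J` on the contact bundle `ker θ`, such that the Levi form
`dθ (X, J X)` is positive on `ker θ`.  Only the values of `J` on `ker θ` are relevant. For sections
`X, Y` of `ker θ` one has `dθ (X, Y) = - θ [X, Y]`, so positivity is stated through brackets; it
makes `θ` a contact form. -/
structure PseudohermitianStructure where
  /-- the contact form -/
  θ : ∀ x : M, TangentSpace I x →L[ℝ] ℝ
  /-- the complex structure on the contact bundle -/
  J : ∀ x : M, TangentSpace I x →L[ℝ] TangentSpace I x
  smooth_θ : ∀ U : Set M, IsOpen U → ∀ X : ∀ x : M, TangentSpace I x, SmoothFieldOn I X U →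
    ContMDiffOn I 𝓘(ℝ, ℝ) ∞ (fun x => θ x (X x)) U
  smooth_J : ∀ U : Set M, IsOpen U → ∀ X : ∀ x : M, TangentSpace I x, SmoothFieldOn I X U →
    (∀ x ∈ U, θ x (X x) = 0) → SmoothFieldOn I (fun x => J x (X x)) U
  θ_ne_zero : ∀ x : M, θ x ≠ 0
  θ_J : ∀ (x : M) (v : TangentSpace I x), θ x v = 0 → θ x (J x v) = 0
  J_J : ∀ (x : M) (v : TangentSpace I x), θ x v = 0 → J x (J x v) = -v
  levi_pos : ∀ U : Set M, IsOpen U → ∀ X : ∀ x : M, TangentSpace I x, SmoothFieldOn I X U →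
    (∀ x ∈ U, θ x (X x) = 0) → ∀ x ∈ U, X x ≠ 0 →
      0 < -(θ x (VectorField.mlieBracket I X (fun y => J y (X y)) x))
  integrable : ∀ U : Set M, IsOpen U → ∀ X Y : ∀ x : M, TangentSpace I x,
    SmoothFieldOn I X U → SmoothFieldOn I Y U →
    (∀ x ∈ U, θ x (X x) = 0) → (∀ x ∈ U, θ x (Y x) = 0) → ∀ x ∈ U,
      θ x (VectorField.mlieBracket I (fun y => J y (X y)) Y x
          + VectorField.mlieBracket I X (fun y => J y (Y y)) x) = 0 ∧
      J x (VectorField.mlieBracket I (fun y => J y (X y)) Y x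
          + VectorField.mlieBracket I X (fun y => J y (Y y)) x)
        = VectorField.mlieBracket I (fun y => J y (X y)) (fun y => J y (Y y)) x
          - VectorField.mlieBracket I X Y x

variable {I}
  {E' : Type*} [NormedAddCommGroup E'] [NormedSpace ℝ E']
  {H' : Type*} [TopologicalSpace H'] {I' : ModelWithCorners ℝ E' H'}
  {N : Type*} [TopologicalSpace N] [ChartedSpace H' N] [IsManifold I' ∞ N]

/-- A diffeomorphism is a pseudohermitian transformation if it preserves the contact forms and
the complex structures of the contact bundles. -/
structure IsPseudohermitianTransformation (P : PseudohermitianStructure I M)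
    (Q : PseudohermitianStructure I' N) (φ : M ≃ₘ^∞⟮I, I'⟯ N) : Prop where
  θ_comp : ∀ (x : M) (v : TangentSpace I x), Q.θ (φ x) (mfderiv I I' φ x v) = P.θ x v
  J_comp : ∀ (x : M) (v : TangentSpace I x), P.θ x v = 0 →
    mfderiv I I' φ x (P.J x v) = Q.J (φ x) (mfderiv I I' φ x v)

end Pseudohermitian

/-! ### The Heisenberg group -/

/-- The space `ℂⁿ × ℝ`, with coordinates `(z, t)`, `z = x + i y`, underlying the Heisenberg
group. -/
abbrev Heis (n : ℕ) : Type := EuclideanSpace ℂ (Fin n) × ℝ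

namespace Heis

variable {n : ℕ}

/-- The imaginary part of the hermitian product `∑ conj (z β) * w β`. -/
def imInner (z : EuclideanSpace ℂ (Fin n)) : EuclideanSpace ℂ (Fin n) →L[ℝ] ℝ :=
  Complex.imCLM.comp ((innerSL ℂ z).restrictScalars ℝ)

/-- Multiplication by `i` on `ℂⁿ`. -/
def mulI : EuclideanSpace ℂ (Fin n) →L[ℝ] EuclideanSpace ℂ (Fin n) :=
  (Complex.I • ContinuousLinearMap.id ℂ (EuclideanSpace ℂ (Fin n))).restrictScalars ℝ

/-- The contact form `Θ = dt + ∑ (x dy - y dx) = dt + Im ∑ conj z dz`. -/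
def contactForm (p : Heis n) : Heis n →L[ℝ] ℝ :=
  ContinuousLinearMap.snd ℝ _ ℝ + (imInner p.1).comp (ContinuousLinearMap.fst ℝ _ ℝ)

/-- The complex structure on `ker Θ`: on the horizontal lifts `e_β`, `e_{n+β}` of `∂/∂x_β`,
`∂/∂y_β` it is `J e_β = e_{n+β}`, `J e_{n+β} = - e_β`; that is, it multiplies the `z`-component of
a horizontal vector by `i`, and the `t`-component is then determined by `Θ = 0`. -/
def complexStructure (p : Heis n) : Heis n →L[ℝ] Heis n :=
  (mulI.prod (-((imInner p.1).comp mulI))).comp (ContinuousLinearMap.fst ℝ _ ℝ)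

/-- The metric on `ker Θ` for which `e_β`, `e_{n+β}` are orthonormal; it is half of
`dΘ (X, J Y)`. -/
def leviMetric (X Y : Heis n) : ℝ := (inner ℂ X.1 Y.1 : ℂ).re

/-- The Reeb vector field `T = ∂/∂t` of `Θ`. -/
def reeb : Heis n := (0, 1)

lemma imInner_apply (z w : EuclideanSpace ℂ (Fin n)) :
    imInner z w = (inner ℂ z w : ℂ).im := rfl

lemma mulI_apply (w : EuclideanSpace ℂ (Fin n)) : mulI w = Complex.I • w := rfl

lemma contactForm_apply (p v : Heis n) :
    contactForm p v = v.2 + (inner ℂ p.1 v.1 : ℂ).im := rfl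

lemma complexStructure_apply (p v : Heis n) :
    complexStructure p v = (Complex.I • v.1, -(inner ℂ p.1 (Complex.I • v.1) : ℂ).im) := rfl

lemma contactForm_fderiv {Y : Heis n → Heis n} {U : Set (Heis n)} (hU : IsOpen U)
    (hY : ContDiffOn ℝ ∞ Y U) (h0 : ∀ q ∈ U, contactForm q (Y q) = 0) {p : Heis n} (hp : p ∈ U)
    (u : Heis n) : contactForm p (fderiv ℝ Y p u) = -(inner ℂ u.1 (Y p).1 : ℂ).im := by
  have hd : HasFDerivAt Y (fderiv ℝ Y p) p :=
    ((hY.differentiableOn (by simp)).differentiableAt (hU.mem_nhds hp)).hasFDerivAt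
  have h1 : HasFDerivAt (fun q : Heis n => q.1) (ContinuousLinearMap.fst ℝ _ ℝ) p :=
    hasFDerivAt_fst
  have h2 : HasFDerivAt (fun q : Heis n => (Y q).1)
      ((ContinuousLinearMap.fst ℝ _ ℝ).comp (fderiv ℝ Y p)) p := hd.fst
  have h3 : HasFDerivAt (fun q : Heis n => (Y q).2)
      ((ContinuousLinearMap.snd ℝ _ ℝ).comp (fderiv ℝ Y p)) p := hd.snd
  have h4 := h3.add (Complex.imCLM.hasFDerivAt.comp p (h1.inner ℂ h2))
  have h5 : HasFDerivAt (fun _ : Heis n => (0 : ℝ)) (0 : Heis n →L[ℝ] ℝ) p :=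
    hasFDerivAt_const _ _
  have h6 := h5.congr_of_eventuallyEq
    (f₁ := (fun q : Heis n => (Y q).2) + (Complex.imCLM ∘ fun q : Heis n => inner ℂ q.1 (Y q).1))
    (by filter_upwards [hU.mem_nhds hp] with q hq using h0 q hq)
  have h7 := DFunLike.congr_fun (h4.unique h6) u
  simp [fderivInnerCLM_apply] at h7
  rw [contactForm_apply]
  linarith

lemma contactForm_lieBracket {X Y : Heis n → Heis n} {U : Set (Heis n)} (hU : IsOpen U)
    (hX : ContDiffOn ℝ ∞ X U) (hY : ContDiffOn ℝ ∞ Y U)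
    (hX0 : ∀ q ∈ U, contactForm q (X q) = 0) (hY0 : ∀ q ∈ U, contactForm q (Y q) = 0)
    {p : Heis n} (hp : p ∈ U) :
    contactForm p (VectorField.lieBracket ℝ X Y p) = -(2 * (inner ℂ (X p).1 (Y p).1 : ℂ).im) := by
  rw [VectorField.lieBracket, map_sub, contactForm_fderiv hU hY hY0 hp,
    contactForm_fderiv hU hX hX0 hp, ← inner_conj_symm (X p).1 (Y p).1, Complex.conj_im]
  ring

lemma contDiffOn_J {X : Heis n → Heis n} {U : Set (Heis n)} (hX : ContDiffOn ℝ ∞ X U) :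
    ContDiffOn ℝ ∞ (fun q => complexStructure q (X q)) U := by
  have h1 : ContDiffOn ℝ ∞ (fun q => mulI (X q).1) U := mulI.contDiff.comp_contDiffOn hX.fst
  have h2 : ContDiffOn ℝ ∞ (fun q : Heis n => inner ℂ q.1 (mulI (X q).1)) U :=
    contDiff_fst.contDiffOn.inner ℂ h1
  exact h1.prodMk (Complex.imCLM.contDiff.comp_contDiffOn h2).neg

lemma contactForm_J (p v : Heis n) : contactForm p (complexStructure p v) = 0 := by
  rw [contactForm_apply, complexStructure_apply]
  exact neg_add_cancel _

lemma fst_fderiv_J {X : Heis n → Heis n} {U : Set (Heis n)} (hU : IsOpen U)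
    (hX : ContDiffOn ℝ ∞ X U) {p : Heis n} (hp : p ∈ U) (u : Heis n) :
    (fderiv ℝ (fun q => complexStructure q (X q)) p u).1 = Complex.I • (fderiv ℝ X p u).1 := by
  have hd : HasFDerivAt X (fderiv ℝ X p) p :=
    ((hX.differentiableOn (by simp)).differentiableAt (hU.mem_nhds hp)).hasFDerivAt
  have hJ := (((contDiffOn_J hX).differentiableOn (by simp)).differentiableAt
    (hU.mem_nhds hp)).hasFDerivAt
  have h1 : HasFDerivAt (fun q => mulI (X q).1) _ p := mulI.hasFDerivAt.comp p hd.fst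
  exact DFunLike.congr_fun (HasFDerivAt.unique hJ.fst h1) u

lemma ext_contactForm {p v w : Heis n} (h : v.1 = w.1)
    (h' : contactForm p v = contactForm p w) : v = w := by
  rw [contactForm_apply, contactForm_apply, h] at h'
  exact Prod.ext h (add_right_cancel h')

lemma mlieBracket_eq (X Y : Heis n → Heis n) (p : Heis n) :
    VectorField.mlieBracket 𝓘(ℝ, Heis n) X Y p = VectorField.lieBracket ℝ X Y p := by
  have h := VectorField.mlieBracketWithin_eq_lieBracketWithin (𝕜 := ℝ) (E := Heis n)
    (V := X) (W := Y) (s := Set.univ)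
  have h' := congrFun (VectorField.mlieBracketWithin_univ (I := 𝓘(ℝ, Heis n)) (M := Heis n)
    (V := X) (W := Y)) p
  exact h'.symm.trans ((congrFun h p).trans
    (congrFun (VectorField.lieBracketWithin_univ (𝕜 := ℝ) (V := X) (W := Y)) p))

lemma smoothFieldOn_iff (X : Heis n → Heis n) (U : Set (Heis n)) :
    SmoothFieldOn 𝓘(ℝ, Heis n) (M := Heis n) X U ↔ ContDiffOn ℝ ∞ X U :=
  contMDiffOn_vectorSpace_iff_contDiffOn

lemma levi_aux {X : Heis n → Heis n} {U : Set (Heis n)} (hU : IsOpen U)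
    (hX : ContDiffOn ℝ ∞ X U) (hX0 : ∀ q ∈ U, contactForm q (X q) = 0) {p : Heis n} (hp : p ∈ U)
    (hne : X p ≠ 0) :
    0 < -(contactForm p (VectorField.lieBracket ℝ X (fun q => complexStructure q (X q)) p)) := by
  rw [contactForm_lieBracket hU hX (contDiffOn_J hX) hX0 (fun q _ => contactForm_J q _) hp, neg_neg,
    complexStructure_apply, inner_smul_right, inner_self_eq_norm_sq_to_K]
  have h : (X p).1 ≠ 0 := fun h => hne (ext_contactForm (p := p) (by simp [h]) (by
    rw [hX0 p hp, map_zero]))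
  have := norm_pos_iff.2 h
  have h2 : (Complex.I * ((‖(X p).1‖ : ℂ)) ^ 2).im = ‖(X p).1‖ ^ 2 := by
    rw [← Complex.ofReal_pow, Complex.im_mul_ofReal]; simp
  erw [h2]
  positivity

lemma integrable_aux {X Y : Heis n → Heis n} {U : Set (Heis n)} (hU : IsOpen U)
    (hX : ContDiffOn ℝ ∞ X U) (hY : ContDiffOn ℝ ∞ Y U)
    (hX0 : ∀ q ∈ U, contactForm q (X q) = 0) (hY0 : ∀ q ∈ U, contactForm q (Y q) = 0)
    {p : Heis n} (hp : p ∈ U) {a b c d : Heis n}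
    (ha : a = VectorField.lieBracket ℝ (fun q => complexStructure q (X q)) Y p)
    (hb : b = VectorField.lieBracket ℝ X (fun q => complexStructure q (Y q)) p)
    (hc : c = VectorField.lieBracket ℝ (fun q => complexStructure q (X q))
      (fun q => complexStructure q (Y q)) p)
    (hd : d = VectorField.lieBracket ℝ X Y p) :
    contactForm p (a + b) = 0 ∧ complexStructure p (a + b) = c - d := by
  subst ha hb hc hd
  have hJX := contDiffOn_J hX
  have hJY := contDiffOn_J hY
  have hJX0 : ∀ q ∈ U, contactForm q (complexStructure q (X q)) = 0 := fun q _ => contactForm_J q _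
  have hJY0 : ∀ q ∈ U, contactForm q (complexStructure q (Y q)) = 0 := fun q _ => contactForm_J q _
  refine ⟨?_, ext_contactForm (p := p) ?_ ?_⟩
  · rw [map_add, contactForm_lieBracket hU hJX hY hJX0 hY0 hp,
      contactForm_lieBracket hU hX hJY hX0 hJY0 hp, complexStructure_apply, complexStructure_apply,
      inner_smul_left, inner_smul_right]
    simp
  · rw [complexStructure_apply]
    simp only [VectorField.lieBracket, Prod.fst_add, Prod.fst_sub, fst_fderiv_J hU hX hp,
      fst_fderiv_J hU hY hp, smul_add, smul_sub, smul_smul, Complex.I_mul_I, neg_smul, one_smul]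
    abel
  · rw [contactForm_J, map_sub, contactForm_lieBracket hU hJX hJY hJX0 hJY0 hp,
      contactForm_lieBracket hU hX hY hX0 hY0 hp, complexStructure_apply, complexStructure_apply,
      inner_smul_left, inner_smul_right, ← mul_assoc]
    simp

/-- The standard pseudohermitian structure of the Heisenberg group. -/
def pseudohermitian (n : ℕ) : PseudohermitianStructure 𝓘(ℝ, Heis n) (Heis n) where
  θ := fun p => contactForm p
  J := fun p => complexStructure p
  smooth_θ := by
    intro U hU X hX
    have hX' : ContDiffOn ℝ ∞ (fun q : Heis n => (X q : Heis n)) U := (smoothFieldOn_iff _ _).1 hX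
    have h2 : ContDiffOn ℝ ∞ (fun q : Heis n => inner ℂ q.1 (X q : Heis n).1) U :=
      contDiff_fst.contDiffOn.inner ℂ hX'.fst
    exact (hX'.snd.add (Complex.imCLM.contDiff.comp_contDiffOn h2)).contMDiffOn
  smooth_J := fun U _ X hX _ => (smoothFieldOn_iff _ _).2 (contDiffOn_J ((smoothFieldOn_iff X U).1 hX))
  θ_ne_zero := fun p h => by
    have h1 : contactForm p (0, 1) = 0 := DFunLike.congr_fun h ((0, 1) : Heis n)
    rw [contactForm_apply] at h1
    simp at h1
  θ_J := fun p v _ => contactForm_J p v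
  J_J := fun p v hv => ext_contactForm (p := p)
    (by
      change Complex.I • (Complex.I • (v : Heis n).1) = -(v : Heis n).1
      rw [smul_smul, Complex.I_mul_I, neg_smul, one_smul])
    (by
      have hv' : contactForm p (v : Heis n) = 0 := hv
      exact (contactForm_J p _).trans (by
        exact ((map_neg (contactForm p) (v : Heis n)).trans
          ((congrArg Neg.neg hv').trans neg_zero)).symm))
  levi_pos := fun U hU X hX h0 p hp hne => by
    have h := levi_aux hU ((smoothFieldOn_iff X U).1 hX) h0 hp hne
    exact (congrArg (fun b : Heis n => 0 < -(contactForm p b)) (mlieBracket_eq _ _ p)).mpr h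
  integrable := fun U hU X Y hX hY hX0 hY0 p hp => by
    exact integrable_aux hU ((smoothFieldOn_iff X U).1 hX) ((smoothFieldOn_iff Y U).1 hY)
      hX0 hY0 hp (mlieBracket_eq _ _ p) (mlieBracket_eq _ _ p) (mlieBracket_eq _ _ p)
      (mlieBracket_eq _ _ p)

lemma existsUnique_aux {V : Type*} [AddCommGroup V] [Module ℝ V] (p : Heis n)
    (L : V →ₗ[ℝ] Heis n) (θ : V →ₗ[ℝ] ℝ) (J : V → V) (hθ : ∀ v, θ v = contactForm p (L v))
    (hne : θ ≠ 0) (hJ0 : ∀ v, θ v = 0 → θ (J v) = 0)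
    (hJ : ∀ v, θ v = 0 → L (J v) = complexStructure p (L v)) :
    ∃! w : Heis n, contactForm p w = 0 ∧ (∀ v, θ v = 0 → leviMetric w (L v) = 0) ∧
      ∃ v, L v = reeb + w := by
  have hreeb : contactForm p reeb = 1 := by rw [contactForm_apply]; simp [reeb]
  obtain ⟨u, hu⟩ : ∃ u, θ u ≠ 0 := by
    by_contra! h
    exact hne (LinearMap.ext h)
  obtain ⟨v₀, hv₀⟩ : ∃ v₀, θ v₀ = 1 := ⟨(θ u)⁻¹ • u, by simp [hu]⟩
  let K : Submodule ℂ (EuclideanSpace ℂ (Fin n)) :=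
    { carrier := {z | ∃ v, θ v = 0 ∧ (L v).1 = z}
      zero_mem' := ⟨0, by simp, by simp⟩
      add_mem' := by
        rintro _ _ ⟨v, hv, rfl⟩ ⟨w, hw, rfl⟩
        exact ⟨v + w, by simp [hv, hw], by simp⟩
      smul_mem' := by
        rintro c _ ⟨v, hv, rfl⟩
        refine ⟨c.re • v + c.im • J v, by simp [hv, hJ0 v hv], ?_⟩
        rw [map_add, map_smul, map_smul, hJ v hv, complexStructure_apply]
        conv_rhs => rw [← Complex.re_add_im c, add_smul, mul_smul]
        rfl }
  obtain ⟨k, ⟨v₁, hv₁, hk⟩, k', hk', hsum⟩ :=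
    K.exists_add_mem_mem_orthogonal (L v₀ - reeb : Heis n).1
  refine ⟨L v₀ - reeb - L v₁, ⟨?_, ?_, ?_⟩, ?_⟩
  · rw [map_sub, map_sub, ← hθ, ← hθ, hreeb, hv₀, hv₁]; simp
  · intro v hv
    have h1 : (L v₀ - reeb - L v₁ : Heis n).1 = k' := by
      rw [Prod.fst_sub, hsum, hk]; simp
    have h2 := K.inner_left_of_mem_orthogonal (u := (L v).1) ⟨v, hv, rfl⟩ hk'
    rw [leviMetric, h1, h2, Complex.zero_re]
  · exact ⟨v₀ - v₁, by rw [map_sub]; abel⟩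
  · rintro w ⟨hw0, hw1, v, hv⟩
    have hd : L (v - (v₀ - v₁)) = w - (L v₀ - reeb - L v₁) := by
      rw [map_sub, map_sub, hv]; abel
    have hw0' : contactForm p (L v₀ - reeb - L v₁) = 0 := by
      rw [map_sub, map_sub, ← hθ, ← hθ, hreeb, hv₀, hv₁]; simp
    have hz : θ (v - (v₀ - v₁)) = 0 := by
      rw [hθ, hd, map_sub, hw0, hw0', sub_zero]
    have h1 := hw1 _ hz
    have h2 : leviMetric (L v₀ - reeb - L v₁) (L (v - (v₀ - v₁))) = 0 := by
      have h1 : (L v₀ - reeb - L v₁ : Heis n).1 = k' := by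
        rw [Prod.fst_sub, hsum, hk]; simp
      have h2 := K.inner_left_of_mem_orthogonal (u := (L (v - (v₀ - v₁))).1) ⟨_, hz, rfl⟩ hk'
      rw [leviMetric, h1, h2, Complex.zero_re]
    rw [hd] at h1 h2
    have h3 : (inner ℂ (w - (L v₀ - reeb - L v₁) : Heis n).1
        (w - (L v₀ - reeb - L v₁) : Heis n).1 : ℂ).re = 0 := by
      conv_lhs => rw [Prod.fst_sub w, inner_sub_left, ← Prod.fst_sub w, Complex.sub_re]
      exact (congrArg₂ (· - ·) h1 h2).trans (sub_zero 0)
    have h4 : (w - (L v₀ - reeb - L v₁) : Heis n).1 = 0 := by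
      rw [inner_self_eq_norm_sq_to_K] at h3
      have h5 : ‖(w - (L v₀ - reeb - L v₁) : Heis n).1‖ ^ 2 = 0 := by
        exact_mod_cast h3
      exact norm_eq_zero.1 (pow_eq_zero_iff two_ne_zero |>.1 h5)
    refine ext_contactForm (p := p) ?_ (hw0.trans hw0'.symm)
    rw [Prod.fst_sub w] at h4
    exact sub_eq_zero.1 h4

end Heis

/-! ### Pseudohermitian submanifolds of the Heisenberg group -/

section Submanifold

variable {E : Type*} [NormedAddCommGroup E] [NormedSpace ℝ E]
  {H : Type*} [TopologicalSpace H] {I : ModelWithCorners ℝ E H}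
  {M : Type*} [TopologicalSpace M] [ChartedSpace H M] [IsManifold I ∞ M] {n : ℕ}

/-- The pseudohermitian manifold `(M, P)` is, through the smooth immersion `f`, a pseudohermitian
submanifold of the Heisenberg group: the contact form of `P` is the restriction of `Θ`, so that
the contact bundle of `M` is the intersection of `TM` with `ker Θ`, and the complex structure of
`P` is the restriction of the one on `ker Θ`. For a submanifold in the literal sense `f` is the
inclusion; neither an embedding nor injectivity of `f` is required. -/
structure IsPseudohermitianSubmanifold (P : PseudohermitianStructure I M) (f : M → Heis n) :
    Prop where
  smooth : ContMDiff I 𝓘(ℝ, Heis n) ∞ f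
  immersion : ∀ x : M, Function.Injective (mfderiv I 𝓘(ℝ, Heis n) f x)
  θ_eq : ∀ (x : M) (v : TangentSpace I x),
    P.θ x v = Heis.contactForm (f x) (mfderiv I 𝓘(ℝ, Heis n) f x v)
  J_eq : ∀ (x : M) (v : TangentSpace I x), P.θ x v = 0 →
    mfderiv I 𝓘(ℝ, Heis n) f x (P.J x v)
      = Heis.complexStructure (f x) (mfderiv I 𝓘(ℝ, Heis n) f x v)

/-- `w` is the value at `x` of the fundamental vector field: it is horizontal, orthogonal to the
contact space of `M`, and `T + w` is tangent to `M`. -/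
structure IsFundamentalVectorAt (P : PseudohermitianStructure I M) (f : M → Heis n) (x : M)
    (w : Heis n) : Prop where
  horizontal : Heis.contactForm (f x) w = 0
  orthogonal : ∀ v : TangentSpace I x, P.θ x v = 0 →
    Heis.leviMetric w (mfderiv I 𝓘(ℝ, Heis n) f x v) = 0
  tangent : ∃ v : TangentSpace I x, mfderiv I 𝓘(ℝ, Heis n) f x v = Heis.reeb + w

theorem IsPseudohermitianSubmanifold.existsUnique_fundamentalVector
    {P : PseudohermitianStructure I M} {f : M → Heis n} (hf : IsPseudohermitianSubmanifold P f)
    (x : M) : ∃! w : Heis n, IsFundamentalVectorAt P f x w := by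
  obtain ⟨w, ⟨h1, h2, h3⟩, hu⟩ := Heis.existsUnique_aux (f x)
    (mfderiv I 𝓘(ℝ, Heis n) f x).toLinearMap (P.θ x).toLinearMap (P.J x) (hf.θ_eq x)
    (fun h => P.θ_ne_zero x (ContinuousLinearMap.ext fun v => LinearMap.congr_fun h v))
    (P.θ_J x) (hf.J_eq x)
  exact ⟨w, ⟨h1, h2, h3⟩, fun w' hw' => hu w' ⟨hw'.1, hw'.2, hw'.3⟩⟩


/-- The fundamental vector field `ν` of a pseudohermitian submanifold: the section of the
orthogonal complement of the contact bundle of `M` in `ker Θ` such that `T + ν` is tangent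
to `M`. -/
def IsPseudohermitianSubmanifold.fundamentalVectorField
    {P : PseudohermitianStructure I M} {f : M → Heis n} (hf : IsPseudohermitianSubmanifold P f)
    (x : M) : Heis n :=
  (hf.existsUnique_fundamentalVector x).choose

end Submanifold

end

/-! Composing with `φ` reduces the hard direction to two immersions `(a, s)` and `(b, r)` of one
manifold that induce the same `θ` and `J`. Because `ν` vanishes nowhere, `a` and `b` are immersions
of real hypersurfaces in `ℂⁿ`, and the derivative of each along the Reeb field `T` spans the complex
orthogonal complement of the image of `ker θ`.

Both immersions give `dθ = 2 Im ⟨da, da⟩`, and together with `J` this makes the two hermitian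
products agree as soon as one argument is horizontal. The only possible discrepancy is `δ = ‖da T‖²
- ‖db T‖²`. Let `G = (a, b)` carry the difference of the two hermitian products, and let `Z = (X -
iY) X G` with `X` horizontal and `Y = J X`. Then `Z` is orthogonal to the image of `dG`, and `⟨Z, Z⟩
= 2 κ² δ` with `κ = θ [X, Y]` (`diffInner_along_along_self`). Comparing normal components, the same
number is a nonpositive multiple of `δ` (`IsAdapted.exists_inner_self_sub`). As `κ ≠ 0` by the
positivity of the Levi form, `δ = 0` (`IsLocalModel.norm_reeb_eq`).

Hence the frame of `a` goes to that of `b` by a unitary map at each point. Symmetry of second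
derivatives against skewness of the derivative of a unitary family kills its derivative in
horizontal directions, and a bracket `[X, J X]` supplies the missing direction
(`IsLocalModel.fderiv_frameTransition`). So `b = U a + c` locally, and `θ` fixes `r` up to a
constant. A rigid motion of this form is determined by its germ on the hypersurface, and
connectedness makes the local motions one. Conversely, a rigid motion preserves the ambient `Θ` and
`J`, hence their restrictions. -/

set_option linter.unusedSectionVars false

noncomputable section

/-! ### Derivatives along vector fields of a normed space -/

section Along

variable {E : Type*} [NormedAddCommGroup E] [NormedSpace ℝ E]
  {F : Type*} [NormedAddCommGroup F] [NormedSpace ℝ F] {Ω : Set E}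

/-- The derivative of the function `f` along the vector field `X`. -/
def along (X : E → E) (f : E → F) (q : E) : F := fderiv ℝ f q (X q)

lemma differentiableAt_of_smooth (hΩ : IsOpen Ω) {f : E → F} (hf : ContDiffOn ℝ ∞ f Ω) {q : E}
    (hq : q ∈ Ω) : DifferentiableAt ℝ f q :=
  (hf.differentiableOn (by simp)).differentiableAt (hΩ.mem_nhds hq)

lemma contDiffOn_along (hΩ : IsOpen Ω) {X : E → E} {f : E → F} (hX : ContDiffOn ℝ ∞ X Ω)
    (hf : ContDiffOn ℝ ∞ f Ω) : ContDiffOn ℝ ∞ (along X f) Ω :=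
  (hf.fderiv_of_isOpen hΩ (by simp)).clm_apply hX

lemma contDiffOn_lieBracket (hΩ : IsOpen Ω) {X Y : E → E} (hX : ContDiffOn ℝ ∞ X Ω)
    (hY : ContDiffOn ℝ ∞ Y Ω) : ContDiffOn ℝ ∞ (VectorField.lieBracket ℝ X Y) Ω :=
  (contDiffOn_along hΩ hX hY).sub (contDiffOn_along hΩ hY hX)

lemma along_congr (hΩ : IsOpen Ω) (X : E → E) {f g : E → F} (h : ∀ q ∈ Ω, f q = g q) {q : E}
    (hq : q ∈ Ω) : along X f q = along X g q := by
  have : f =ᶠ[nhds q] g := Filter.eventually_of_mem (hΩ.mem_nhds hq) h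
  rw [along, along, this.fderiv_eq]

lemma along_eq_zero (hΩ : IsOpen Ω) (X : E → E) {f : E → F} (h : ∀ q ∈ Ω, f q = 0) {q : E}
    (hq : q ∈ Ω) : along X f q = 0 := by
  rw [along_congr hΩ X h hq, along, fderiv_fun_const]
  rfl

lemma along_sub_along (hΩ : IsOpen Ω) {X Y : E → E} {f : E → F} (hX : ContDiffOn ℝ ∞ X Ω)
    (hY : ContDiffOn ℝ ∞ Y Ω) (hf : ContDiffOn ℝ ∞ f Ω) {q : E} (hq : q ∈ Ω) :
    along X (along Y f) q - along Y (along X f) q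
      = along (VectorField.lieBracket ℝ X Y) f q :=
  (VectorField.fderiv_apply_lieBracket (n := ∞) (hf.contDiffAt (hΩ.mem_nhds hq))
    (by rw [minSmoothness_of_isRCLikeNormedField]; exact ENat.LEInfty.out)
    (differentiableAt_of_smooth hΩ hY hq) (differentiableAt_of_smooth hΩ hX hq)).symm

lemma along_sub (hΩ : IsOpen Ω) (X : E → E) {f g : E → F} (hf : ContDiffOn ℝ ∞ f Ω)
    (hg : ContDiffOn ℝ ∞ g Ω) {q : E} (hq : q ∈ Ω) :
    along X (fun q => f q - g q) q = along X f q - along X g q := by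
  rw [along, fderiv_fun_sub (differentiableAt_of_smooth hΩ hf hq)
    (differentiableAt_of_smooth hΩ hg hq)]
  rfl

lemma along_add (hΩ : IsOpen Ω) (X : E → E) {f g : E → F} (hf : ContDiffOn ℝ ∞ f Ω)
    (hg : ContDiffOn ℝ ∞ g Ω) {q : E} (hq : q ∈ Ω) :
    along X (fun q => f q + g q) q = along X f q + along X g q := by
  rw [along, fderiv_fun_add (differentiableAt_of_smooth hΩ hf hq)
    (differentiableAt_of_smooth hΩ hg hq)]
  rfl

lemma along_const_smul {W : Type*} [NormedAddCommGroup W] [NormedSpace ℂ W] (hΩ : IsOpen Ω)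
    (X : E → E) {f : E → W} (hf : ContDiffOn ℝ ∞ f Ω) (c : ℂ) {q : E} (hq : q ∈ Ω) :
    along X (fun q => c • f q) q = c • along X f q := by
  have h := (differentiableAt_of_smooth hΩ hf hq)
  rw [along, fderiv_fun_const_smul h]
  rfl

end Along

/-! ### The difference of two hermitian products -/

section Pairing

variable {V : Type*} [NormedAddCommGroup V] [InnerProductSpace ℂ V]

/-- The indefinite hermitian form on `V × V` that is the difference of the two hermitian
products. -/
def diffInner (x y : V × V) : ℂ := inner ℂ x.1 y.1 - inner ℂ x.2 y.2

lemma diffInner_add_left (x y z : V × V) :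
    diffInner (x + y) z = diffInner x z + diffInner y z := by
  simp only [diffInner, Prod.fst_add, Prod.snd_add, inner_add_left]; ring

lemma diffInner_add_right (x y z : V × V) :
    diffInner x (y + z) = diffInner x y + diffInner x z := by
  simp only [diffInner, Prod.fst_add, Prod.snd_add, inner_add_right]; ring

lemma diffInner_sub_left (x y z : V × V) :
    diffInner (x - y) z = diffInner x z - diffInner y z := by
  simp only [diffInner, Prod.fst_sub, Prod.snd_sub, inner_sub_left]; ring

lemma diffInner_sub_right (x y z : V × V) :
    diffInner x (y - z) = diffInner x y - diffInner x z := by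
  simp only [diffInner, Prod.fst_sub, Prod.snd_sub, inner_sub_right]; ring

lemma diffInner_smul_left (c : ℂ) (x y : V × V) :
    diffInner (c • x) y = (starRingEnd ℂ) c * diffInner x y := by
  simp only [diffInner, Prod.smul_fst, Prod.smul_snd, inner_smul_left]; ring

lemma diffInner_smul_right (c : ℂ) (x y : V × V) :
    diffInner x (c • y) = c * diffInner x y := by
  simp only [diffInner, Prod.smul_fst, Prod.smul_snd, inner_smul_right]; ring

variable {E : Type*} [NormedAddCommGroup E] [NormedSpace ℝ E] {Ω : Set E}

lemma along_inner (hΩ : IsOpen Ω) (X : E → E) {f g : E → V} (hf : ContDiffOn ℝ ∞ f Ω)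
    (hg : ContDiffOn ℝ ∞ g Ω) {q : E} (hq : q ∈ Ω) :
    along X (fun q => inner ℂ (f q) (g q)) q
      = inner ℂ (along X f q) (g q) + inner ℂ (f q) (along X g q) := by
  have h1 := differentiableAt_of_smooth hΩ hf hq
  have h2 := differentiableAt_of_smooth hΩ hg hq
  rw [along, fderiv_inner_apply ℂ h1 h2, add_comm]
  rfl

lemma along_diffInner (hΩ : IsOpen Ω) (X : E → E) {f g : E → V × V} (hf : ContDiffOn ℝ ∞ f Ω)
    (hg : ContDiffOn ℝ ∞ g Ω) {q : E} (hq : q ∈ Ω) :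
    along X (fun q => diffInner (f q) (g q)) q
      = diffInner (along X f q) (g q) + diffInner (f q) (along X g q) := by
  have hf' := differentiableAt_of_smooth hΩ hf hq
  have hg' := differentiableAt_of_smooth hΩ hg hq
  have h1 := along_inner hΩ X hf.fst hg.fst hq
  have h2 := along_inner hΩ X hf.snd hg.snd hq
  have h5 := along_sub hΩ X (hf.fst.inner ℂ hg.fst) (hf.snd.inner ℂ hg.snd) hq
  change _ = _ - _ at h5
  change along X (fun q => inner ℂ (f q).1 (g q).1 - inner ℂ (f q).2 (g q).2) q = _
  rw [h5, h1, h2]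
  have e1 : ∀ f : E → V × V, DifferentiableAt ℝ f q →
      along X (fun q => (f q).1) q = (along X f q).1 := fun f hf => by
    rw [along, hf.hasFDerivAt.fst.fderiv]; rfl
  have e2 : ∀ f : E → V × V, DifferentiableAt ℝ f q →
      along X (fun q => (f q).2) q = (along X f q).2 := fun f hf => by
    rw [along, hf.hasFDerivAt.snd.fderiv]; rfl
  rw [e1 f hf', e1 g hg', e2 f hf', e2 g hg']
  simp only [diffInner]
  ring

/-! ### Second and third derivatives of a map with `dG ∘ J = i dG` on `ker θ` -/

variable {G : E → V × V}

/-- `X + iY` annihilates `G`, so commuting it past `R` leaves only first derivatives of `G`, along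
brackets. -/
lemma along_add_I_smul_along (hΩ : IsOpen Ω) (hG : ContDiffOn ℝ ∞ G Ω) {X Y R : E → E}
    (hX : ContDiffOn ℝ ∞ X Ω) (hY : ContDiffOn ℝ ∞ Y Ω) (hR : ContDiffOn ℝ ∞ R Ω)
    (hXY : ∀ q ∈ Ω, along Y G q = Complex.I • along X G q) {q : E} (hq : q ∈ Ω) :
    along X (along R G) q + Complex.I • along Y (along R G) q
      = along (VectorField.lieBracket ℝ X R) G q
        + Complex.I • along (VectorField.lieBracket ℝ Y R) G q := by
  have h := along_congr hΩ R hXY hq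
  rw [along_const_smul hΩ R (contDiffOn_along hΩ hX hG) _ hq] at h
  rw [← along_sub_along hΩ hX hR hG hq, ← along_sub_along hΩ hY hR hG hq, h, smul_sub, smul_smul,
    Complex.I_mul_I, neg_smul, one_smul]
  abel

/-- If `diffInner f g = 0`, differentiating along `X + i Y`. -/
lemma diffInner_along_sub_I_smul (hΩ : IsOpen Ω) (X Y : E → E) {f g : E → V × V}
    (hf : ContDiffOn ℝ ∞ f Ω) (hg : ContDiffOn ℝ ∞ g Ω)
    (h0 : ∀ q ∈ Ω, diffInner (f q) (g q) = 0) {q : E} (hq : q ∈ Ω) :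
    diffInner (along X f q - Complex.I • along Y f q) (g q)
      = -diffInner (f q) (along X g q + Complex.I • along Y g q) := by
  have h1 := along_eq_zero hΩ X h0 hq
  have h2 := along_eq_zero hΩ Y h0 hq
  rw [along_diffInner hΩ _ hf hg hq] at h1 h2
  simp only [diffInner_sub_left, diffInner_smul_left, diffInner_add_right, diffInner_smul_right,
    Complex.conj_I]
  linear_combination h1 + Complex.I * h2

variable {θ : E → E →L[ℝ] ℝ} {δ : E → ℝ}

/-- The product of `X G` with `R G` is identically zero since `θ X = 0`. Differentiating it moves `X
- iY` on the left to `-(X + iY)` on `R G`, which is of first order, and first derivatives pair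
trivially with `X G`. -/
lemma diffInner_along_along_horizontal (hΩ : IsOpen Ω) (hG : ContDiffOn ℝ ∞ G Ω)
    (hδ : ∀ q ∈ Ω, ∀ u v, diffInner (fderiv ℝ G q u) (fderiv ℝ G q v) = θ q u * θ q v * δ q)
    {X Y : E → E} (hX : ContDiffOn ℝ ∞ X Ω) (hY : ContDiffOn ℝ ∞ Y Ω)
    (hXY : ∀ q ∈ Ω, along Y G q = Complex.I • along X G q) (hθX : ∀ q ∈ Ω, θ q (X q) = 0)
    {R : E → E} (hR : ContDiffOn ℝ ∞ R Ω) {q : E} (hq : q ∈ Ω) :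
    diffInner (along X (along X G) q - Complex.I • along Y (along X G) q) (along R G q) = 0 := by
  have h0 : ∀ q ∈ Ω, diffInner (along X G q) (along R G q) = 0 := fun q hq => by
    rw [along, along, hδ q hq, hθX q hq]; simp
  rw [diffInner_along_sub_I_smul hΩ X Y (contDiffOn_along hΩ hX hG) (contDiffOn_along hΩ hR hG)
    h0 hq, along_add_I_smul_along hΩ hG hX hY hR hXY hq, diffInner_add_right,
    diffInner_smul_right, along, along, along, hδ q hq, hδ q hq, hθX q hq]
  simp

/-- A Gauss-type identity. With `Z = (X - iY) X G`, differentiating `⟨Z, X G⟩ = 0` gives `⟨Z, Z⟩ =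
-⟨(X + iY) Z, X G⟩`. The third derivative of `G` along `X` cancels in `(X + iY) Z`, and what
survives is a multiple of `⟨R G, R G⟩ = θ(R)² δ`. -/
lemma diffInner_along_along_self (hΩ : IsOpen Ω) (hG : ContDiffOn ℝ ∞ G Ω)
    (hδ : ∀ q ∈ Ω, ∀ u v, diffInner (fderiv ℝ G q u) (fderiv ℝ G q v) = θ q u * θ q v * δ q)
    {X Y : E → E} (hX : ContDiffOn ℝ ∞ X Ω) (hY : ContDiffOn ℝ ∞ Y Ω)
    (hXY : ∀ q ∈ Ω, along Y G q = Complex.I • along X G q) (hθX : ∀ q ∈ Ω, θ q (X q) = 0)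
    {q : E} (hq : q ∈ Ω) :
    diffInner (along X (along X G) q - Complex.I • along Y (along X G) q)
        (along X (along X G) q - Complex.I • along Y (along X G) q)
      = 2 * (θ q (VectorField.lieBracket ℝ X Y q)) ^ 2 * δ q := by
  set R := VectorField.lieBracket ℝ X Y with hRdef
  have hR : ContDiffOn ℝ ∞ R Ω := contDiffOn_lieBracket hΩ hX hY
  have he := contDiffOn_along hΩ hX hG
  have hf := contDiffOn_along hΩ hR hG
  have hXe := contDiffOn_along hΩ hX he
  have hIXe : ∀ q ∈ Ω, along Y (along X G) q
      = Complex.I • along X (along X G) q - along R G q := fun q hq => by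
    have h := along_congr hΩ X hXY hq
    rw [along_const_smul hΩ X he _ hq] at h
    rw [hRdef, ← along_sub_along hΩ hX hY hG hq, h]; abel
  have hIXe' : ContDiffOn ℝ ∞ (fun q => Complex.I • along X (along X G) q) Ω :=
    hXe.const_smul _
  have hZ : ∀ q ∈ Ω, along X (along X G) q - Complex.I • along Y (along X G) q
      = (2 : ℂ) • along X (along X G) q + Complex.I • along R G q := fun q hq => by
    rw [hIXe q hq, smul_sub, smul_smul, Complex.I_mul_I, neg_smul, one_smul, two_smul]
    abel
  have h2Xe : ContDiffOn ℝ ∞ (fun q => (2 : ℂ) • along X (along X G) q) Ω :=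
    hXe.const_smul _
  have hIf : ContDiffOn ℝ ∞ (fun q => Complex.I • along R G q) Ω := hf.const_smul _
  -- the pairing with `e` vanishes; differentiate it along `X` and `Y`
  have h0 : ∀ q ∈ Ω, diffInner ((2 : ℂ) • along X (along X G) q + Complex.I • along R G q)
      (along X G q) = 0 := fun q hq => by
    rw [← hZ q hq]
    exact diffInner_along_along_horizontal hΩ hG hδ hX hY hXY hθX hX hq
  have h1 := along_eq_zero hΩ X h0 hq
  have h2 := along_eq_zero hΩ Y h0 hq
  rw [along_diffInner hΩ _ (h2Xe.add hIf) he hq, along_add hΩ _ h2Xe hIf hq,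
    along_const_smul hΩ _ hXe _ hq, along_const_smul hΩ _ hf _ hq] at h1 h2
  -- Two expressions for `R X G`: from `R = [X, Y]`, and by commuting `R` past `X`. Equating them
  -- turns `(X + iY) X X G` into `-2i X R G + i [X, R] G`.
  have hRe : along R (along X G) q
      = along X (along Y (along X G)) q - along Y (along X (along X G)) q :=
    (along_sub_along hΩ hX hY he hq).symm
  have hRe' : along R (along X G) q = along X (along R G) q
      - along (VectorField.lieBracket ℝ X R) G q := by
    rw [← along_sub_along hΩ hX hR hG hq]; abel
  have hX3 : along X (along Y (along X G)) q
      = Complex.I • along X (along X (along X G)) q - along X (along R G) q := by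
    rw [along_congr hΩ X hIXe hq, along_sub hΩ X hIXe' hf hq, along_const_smul hΩ X hXe _ hq]
  have h3 := diffInner_along_sub_I_smul hΩ X Y hf he (fun q hq => by
    rw [along, along, hδ q hq, hθX q hq]; simp) hq
  have h4 := along_add_I_smul_along hΩ hG hX hY hR hXY hq
  have h5 : diffInner (along X (along R G) q + Complex.I • along Y (along R G) q)
      (along X G q) = 0 := by
    rw [h4, diffInner_add_left, diffInner_smul_left, along, along, along, hδ q hq, hδ q hq,
      hθX q hq]
    simp
  have h6 : diffInner (along (VectorField.lieBracket ℝ X R) G q) (along X G q) = 0 := by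
    rw [along, along, hδ q hq, hθX q hq]; simp
  have h7 : diffInner (along R G q) (along R G q) = (θ q (R q)) ^ 2 * δ q := by
    rw [along, hδ q hq]; ring
  have h8 := congrArg (fun w => diffInner w (along X G q)) (hRe.symm.trans hRe')
  rw [hX3] at h8
  rw [hIXe q hq] at h2 h3
  rw [hZ q hq]
  simp only [diffInner_sub_left, diffInner_smul_left, diffInner_add_right, diffInner_smul_right,
    diffInner_add_left, diffInner_sub_right, Complex.conj_I, map_ofNat] at h1 h2 h3 h5 h6 h8 ⊢
  -- `h1 - i h2` produces `⟨Z, Z⟩`; `h8` and `h6` reduce the third-order term to `⟨X R G, X G⟩`;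
  -- `h3` and `h5` evaluate that through `(X - iY) R G` and `(X + iY) R G`.
  linear_combination (norm := (ring_nf; simp only [Complex.I_sq, Complex.I_pow_three]; ring))
    h1 - Complex.I * h2 - 2 * Complex.I * (h8 - h6) - Complex.I * h5 - 2 * Complex.I * h3 + 2 * h7

end Pairing

/-! ### Linear algebra of a real hyperplane in a hermitian space -/

section Pointwise

variable {E : Type*} [NormedAddCommGroup E] [NormedSpace ℝ E] [FiniteDimensional ℝ E]
  {V : Type*} [NormedAddCommGroup V] [InnerProductSpace ℂ V] [FiniteDimensional ℂ V]

/-- `A` embeds `E` as a real hyperplane of `V`, and `A T` is orthogonal to the image of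
`ker θ`. -/
structure IsAdapted (θ : E →L[ℝ] ℝ) (A : E →L[ℝ] V) (T : E) : Prop where
  θ_reeb : θ T = 1
  inner_reeb : ∀ v, (inner ℂ (A T) (A v) : ℂ) = θ v * ((‖A T‖ ^ 2 : ℝ) : ℂ)
  reeb_ne_zero : A T ≠ 0
  injective : ∀ u, θ u = 0 → A u = 0 → u = 0
  finrank_eq : Module.finrank ℝ E + 1 = 2 * Module.finrank ℂ V

/-- The extension of `A : E → V` to `E × ℝ` by a vector of `V`. -/
def extendBy (A : E →L[ℝ] V) (w : V) : E × ℝ →L[ℝ] V :=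
  A.coprod (ContinuousLinearMap.toSpanSingleton ℝ w)

lemma extendBy_apply (A : E →L[ℝ] V) (w : V) (x : E × ℝ) :
    extendBy A w x = A x.1 + x.2 • w := by
  simp [extendBy]

variable {θ : E →L[ℝ] ℝ} {A B : E →L[ℝ] V} {T : E}

/-- The vector `i A T` is normal to the real hyperplane `A E`: pairing `A u + r i A T` with `A T`
reads off `θ u + i r` times `‖A T‖²`. -/
lemma IsAdapted.injective_extendBy (h : IsAdapted θ A T) :
    Function.Injective (extendBy A (Complex.I • A T)) := by
  rw [injective_iff_map_eq_zero]
  rintro ⟨u, r⟩ hu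
  rw [extendBy_apply] at hu
  have hne : (‖A T‖ : ℂ) ≠ 0 := by exact_mod_cast norm_ne_zero_iff.2 h.reeb_ne_zero
  have h1 := congrArg (fun w => inner ℂ (A T) w) hu
  simp only [inner_add_right, inner_zero_right, h.inner_reeb, ← Complex.coe_smul,
    inner_smul_right, h.θ_reeb] at h1
  have h2 : ((θ u : ℂ) + r * Complex.I) * ((‖A T‖ ^ 2 : ℝ) : ℂ) = 0 := by
    rw [← h1]; push_cast; ring
  have h3 := (mul_eq_zero.1 h2).resolve_right (by push_cast; exact pow_ne_zero 2 hne)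
  have hr : r = 0 := by simpa using congrArg Complex.im h3
  have hθ : θ u = 0 := by simpa using congrArg Complex.re h3
  subst hr
  rw [zero_smul, add_zero] at hu
  rw [h.injective u hθ hu]
  rfl

lemma IsAdapted.finrank_prod_eq (h : IsAdapted θ A T) :
    Module.finrank ℝ (E × ℝ) = Module.finrank ℝ V := by
  rw [Module.finrank_prod, Module.finrank_self, h.finrank_eq, finrank_real_of_complex]

lemma IsAdapted.surjective_extendBy (h : IsAdapted θ A T) :
    Function.Surjective (extendBy A (Complex.I • A T)) := by
  have : FiniteDimensional ℝ V := FiniteDimensional.complexToReal V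
  exact ((LinearMap.injective_iff_surjective_of_finrank_eq_finrank h.finrank_prod_eq
    (f := (extendBy A (Complex.I • A T)).toLinearMap))).1 h.injective_extendBy

/-- The orthogonal splitting `V = A (ker θ) ⊕ ℂ A T`, used below as coordinates. -/
lemma IsAdapted.exists_eq_add (h : IsAdapted θ A T) (w : V) :
    ∃ (x : E) (c : ℂ), θ x = 0 ∧ w = A x + c • A T := by
  obtain ⟨⟨u, r⟩, rfl⟩ := h.surjective_extendBy w
  refine ⟨u - θ u • T, θ u + r * Complex.I, by simp [h.θ_reeb], ?_⟩
  rw [extendBy_apply, map_sub, map_smul, add_smul, mul_smul, Complex.coe_smul, Complex.coe_smul]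
  abel

lemma IsAdapted.eq_of_inner (h : IsAdapted θ A T) {w w' : V}
    (hw : ∀ u, (inner ℂ w (A u) : ℂ) = inner ℂ w' (A u)) : w = w' := by
  refine ext_inner_right ℂ fun z => ?_
  obtain ⟨x, c, -, rfl⟩ := h.exists_eq_add z
  rw [inner_add_right, inner_add_right, inner_smul_right, inner_smul_right, hw, hw]

lemma IsAdapted.inner_reeb_horizontal (h : IsAdapted θ A T) {v : E} (hv : θ v = 0) :
    (inner ℂ (A T) (A v) : ℂ) = 0 := by
  rw [h.inner_reeb, hv]; simp

lemma IsAdapted.inner_horizontal_reeb (h : IsAdapted θ A T) {v : E} (hv : θ v = 0) :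
    (inner ℂ (A v) (A T) : ℂ) = 0 := by
  rw [← inner_conj_symm, h.inner_reeb_horizontal hv, map_zero]

lemma IsAdapted.inner_add_self (h : IsAdapted θ A T) {x : E} (hx : θ x = 0) (c : ℂ) :
    (inner ℂ (A x + c • A T) (A x + c • A T) : ℂ)
      = inner ℂ (A x) (A x) + (Complex.normSq c * ‖A T‖ ^ 2 : ℝ) := by
  simp only [inner_add_left, inner_add_right, inner_smul_left, inner_smul_right,
    h.inner_reeb_horizontal hx, h.inner_horizontal_reeb hx, h.inner_reeb, h.θ_reeb]
  push_cast
  rw [← Complex.mul_conj]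
  ring

/-- The normal components of two vectors with the same tangential products. -/
lemma IsAdapted.exists_inner_self_sub (hA : IsAdapted θ A T) (hB : IsAdapted θ B T)
    (hAB : ∀ x y, θ x = 0 → θ y = 0 → (inner ℂ (A x) (A y) : ℂ) = inner ℂ (B x) (B y))
    {α β : V} (h : ∀ u, (inner ℂ α (A u) : ℂ) = inner ℂ β (B u)) :
    ∃ k : ℝ, (inner ℂ α α - inner ℂ β β : ℂ) * ((‖A T‖ ^ 2 * ‖B T‖ ^ 2 : ℝ) : ℂ)
      = ((k ^ 2 * (‖B T‖ ^ 2 - ‖A T‖ ^ 2) : ℝ) : ℂ) := by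
  obtain ⟨x, c, hx, rfl⟩ := hA.exists_eq_add α
  obtain ⟨y, d, hy, rfl⟩ := hB.exists_eq_add β
  have h1 : B x = B y := by
    -- Testing on the horizontal vector `x - y` removes the components along `A T` and `B T`,
    -- leaving `‖B (x - y)‖² = 0`.
    have hxy : θ (x - y) = 0 := by rw [map_sub, hx, hy, sub_zero]
    have h2 := h (x - y)
    rw [inner_add_left, inner_add_left, inner_smul_left, inner_smul_left,
      hA.inner_reeb_horizontal hxy, hB.inner_reeb_horizontal hxy, mul_zero, mul_zero, add_zero,
      add_zero, hAB x _ hx hxy, ← sub_eq_zero, ← inner_sub_left, ← map_sub,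
      inner_self_eq_zero, map_sub] at h2
    exact sub_eq_zero.1 h2
  have h3 := h T
  rw [inner_add_left, inner_add_left, inner_smul_left, inner_smul_left,
    hA.inner_horizontal_reeb hx, hB.inner_horizontal_reeb hy, hA.inner_reeb, hB.inner_reeb,
    hA.θ_reeb] at h3
  have h4 := congrArg Complex.normSq h3
  simp only [zero_add, map_mul, Complex.normSq_conj, Complex.ofReal_one, one_mul,
    Complex.normSq_ofReal] at h4
  -- Testing on `T` gave `|c| ‖A T‖² = |d| ‖B T‖²`; `k` is this common value. The horizontal parts
  -- cancel, so the difference of the squared norms is `k² (1/‖A T‖² - 1/‖B T‖²)`.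
  refine ⟨Real.sqrt (Complex.normSq c) * ‖A T‖ ^ 2, ?_⟩
  rw [hA.inner_add_self hx, hB.inner_add_self hy, hAB x x hx hx, h1, add_sub_add_left_eq_sub,
    ← Complex.ofReal_sub, ← Complex.ofReal_mul, mul_pow, Real.sq_sqrt (Complex.normSq_nonneg _)]
  congr 1
  linear_combination ‖A T‖ ^ 2 * h4

/-- Two adapted embeddings with the same induced metric differ by a unitary map. -/
lemma IsAdapted.inner_eq (hA : IsAdapted θ A T) (hB : IsAdapted θ B T)
    (hAB : ∀ x y, θ x = 0 → θ y = 0 → (inner ℂ (A x) (A y) : ℂ) = inner ℂ (B x) (B y))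
    (hT : ‖A T‖ ^ 2 = ‖B T‖ ^ 2) (u v : E) :
    (inner ℂ (A u) (A v) : ℂ) = inner ℂ (B u) (B v) := by
  have key : ∀ u, ∃ x, θ x = 0 ∧ u = x + θ u • T := fun u =>
    ⟨u - θ u • T, by simp [hA.θ_reeb], by simp⟩
  obtain ⟨x, hx, hu⟩ := key u
  obtain ⟨y, hy, hv⟩ := key v
  rw [hu, hv]
  simp only [map_add, map_smul, inner_add_left, inner_add_right, ← Complex.coe_smul,
    inner_smul_left, inner_smul_right, hA.inner_reeb_horizontal hy, hA.inner_horizontal_reeb hx,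
    hB.inner_reeb_horizontal hy, hB.inner_horizontal_reeb hx, hA.inner_reeb T, hB.inner_reeb T,
    hAB x y hx hy, hT]

lemma inner_extendBy (hAB : ∀ u v, (inner ℂ (A u) (A v) : ℂ) = inner ℂ (B u) (B v))
    (x y : E × ℝ) :
    (inner ℂ (extendBy A (Complex.I • A T) x) (extendBy A (Complex.I • A T) y) : ℂ)
      = inner ℂ (extendBy B (Complex.I • B T) x) (extendBy B (Complex.I • B T) y) := by
  simp only [extendBy_apply, inner_add_left, inner_add_right, ← Complex.coe_smul,
    inner_smul_left, inner_smul_right, hAB]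

end Pointwise

/-! ### Smooth solutions of linear equations -/

section Solutions

variable {E : Type*} [NormedAddCommGroup E] [NormedSpace ℝ E] {Ω : Set E}
  {F₁ F₂ : Type*} [NormedAddCommGroup F₁] [NormedSpace ℝ F₁] [FiniteDimensional ℝ F₁]
  [NormedAddCommGroup F₂] [NormedSpace ℝ F₂] [FiniteDimensional ℝ F₂]

lemma isInvertible_of_injective (hd : Module.finrank ℝ F₁ = Module.finrank ℝ F₂)
    {L : F₁ →L[ℝ] F₂} (h : Function.Injective L) : L.IsInvertible :=
  ⟨(LinearEquiv.ofInjectiveOfFinrankEq L.toLinearMap h hd).toContinuousLinearEquiv, by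
    ext x; rfl⟩

lemma contDiffOn_inverse (hd : Module.finrank ℝ F₁ = Module.finrank ℝ F₂)
    {L : E → F₁ →L[ℝ] F₂} (hL : ContDiffOn ℝ ∞ L Ω)
    (hinj : ∀ q ∈ Ω, Function.Injective (L q)) :
    ContDiffOn ℝ ∞ (fun q => (L q).inverse) Ω := by
  have := FiniteDimensional.complete ℝ F₁
  exact fun q hq => ((isInvertible_of_injective hd (hinj q hq)).contDiffAt_map_inverse
    ).comp_contDiffWithinAt q (hL q hq)

lemma contDiffOn_of_solution (hd : Module.finrank ℝ F₁ = Module.finrank ℝ F₂)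
    {L : E → F₁ →L[ℝ] F₂} (hL : ContDiffOn ℝ ∞ L Ω)
    (hinj : ∀ q ∈ Ω, Function.Injective (L q)) {X : E → F₁}
    (hX : ContDiffOn ℝ ∞ (fun q => L q (X q)) Ω) : ContDiffOn ℝ ∞ X Ω := by
  refine ((contDiffOn_inverse hd hL hinj).clm_apply hX).congr fun q hq => ?_
  rw [← ContinuousLinearMap.comp_apply,
    (isInvertible_of_injective hd (hinj q hq)).inverse_comp_self]
  rfl

end Solutions

/-! ### Pseudohermitian hypersurfaces of the Heisenberg group in a chart -/

section Local

variable {E : Type*} [NormedAddCommGroup E] [NormedSpace ℝ E] [FiniteDimensional ℝ E]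
  {V : Type*} [NormedAddCommGroup V] [InnerProductSpace ℂ V] [FiniteDimensional ℂ V]
  {Ω : Set E} {θ : E → E →L[ℝ] ℝ} {J : E → E → E} {T T' : E → E} {a b : E → V} {s r : E → ℝ}

/-- On the open set `Ω`, the map `(a, s)` to the Heisenberg group is an immersion inducing the
contact form `θ` and the complex structure `J`, with Reeb field `T`, and its fundamental vector
field vanishes nowhere. -/
structure IsLocalModel (Ω : Set E) (θ : E → E →L[ℝ] ℝ) (J : E → E → E) (T : E → E) (a : E → V)
    (s : E → ℝ) : Prop where
  isOpen : IsOpen Ω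
  smooth_fst : ContDiffOn ℝ ∞ a Ω
  smooth_snd : ContDiffOn ℝ ∞ s Ω
  θ_eq : ∀ q ∈ Ω, ∀ u, θ q u = fderiv ℝ s q u + (inner ℂ (a q) (fderiv ℝ a q u) : ℂ).im
  θ_J : ∀ q ∈ Ω, ∀ u, θ q u = 0 → θ q (J q u) = 0
  fderiv_J : ∀ q ∈ Ω, ∀ u, θ q u = 0 → fderiv ℝ a q (J q u) = Complex.I • fderiv ℝ a q u
  adapted : ∀ q ∈ Ω, IsAdapted (θ q) (fderiv ℝ a q) (T q)

namespace IsLocalModel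

/-- The formula `X (θ Y) - Y (θ X) = θ [X, Y] + dθ (X, Y)`. -/
lemma along_θ_sub (h : IsLocalModel Ω θ J T a s) {X Y : E → E} (hX : ContDiffOn ℝ ∞ X Ω)
    (hY : ContDiffOn ℝ ∞ Y Ω) {q : E} (hq : q ∈ Ω) :
    along X (fun q => θ q (Y q)) q - along Y (fun q => θ q (X q)) q
      = θ q (VectorField.lieBracket ℝ X Y q)
        + 2 * (inner ℂ (fderiv ℝ a q (X q)) (fderiv ℝ a q (Y q)) : ℂ).im := by
  have hΩ := h.isOpen
  have key : ∀ {X Y : E → E}, ContDiffOn ℝ ∞ X Ω → ContDiffOn ℝ ∞ Y Ω →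
      along X (fun q => θ q (Y q)) q = along X (along Y s) q
        + (inner ℂ (along X a q) (along Y a q) + inner ℂ (a q) (along X (along Y a) q) : ℂ).im := by
    intro X Y hX hY
    have hs := contDiffOn_along hΩ hY h.smooth_snd
    have ha := contDiffOn_along hΩ hY h.smooth_fst
    have hi : ContDiffOn ℝ ∞ (fun q => (inner ℂ (a q) (along Y a q) : ℂ)) Ω :=
      h.smooth_fst.inner ℂ ha
    refine (along_congr hΩ X (fun q hq => h.θ_eq q hq (Y q)) hq).trans
      ((along_add hΩ X hs (Complex.imCLM.contDiff.comp_contDiffOn hi) hq).trans ?_)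
    rw [← along_inner hΩ X h.smooth_fst ha hq]
    congr 1
    have h1 := (Complex.imCLM.hasFDerivAt.comp q
      (differentiableAt_of_smooth hΩ hi hq).hasFDerivAt).fderiv
    exact DFunLike.congr_fun h1 (X q)
  have h1 := along_sub_along hΩ hX hY h.smooth_snd hq
  have h2 := along_sub_along hΩ hX hY h.smooth_fst hq
  have h3 : (inner ℂ (along Y a q) (along X a q) : ℂ).im
      = -(inner ℂ (along X a q) (along Y a q) : ℂ).im := by
    rw [← inner_conj_symm, Complex.conj_im]
  rw [key hX hY, key hY hX, h.θ_eq q hq]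
  change _ = along _ s q + (inner ℂ (a q) (along _ a q)).im
    + 2 * (inner ℂ (along X a q) (along Y a q)).im
  rw [← h1, ← h2, inner_sub_right, Complex.add_im, Complex.add_im, Complex.sub_im, h3]
  ring

lemma θ_lieBracket (h : IsLocalModel Ω θ J T a s) {X Y : E → E} (hX : ContDiffOn ℝ ∞ X Ω)
    (hY : ContDiffOn ℝ ∞ Y Ω) (hθX : ∀ q ∈ Ω, θ q (X q) = 0) (hθY : ∀ q ∈ Ω, θ q (Y q) = 0)
    {q : E} (hq : q ∈ Ω) :
    θ q (VectorField.lieBracket ℝ X Y q)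
      = -(2 * (inner ℂ (fderiv ℝ a q (X q)) (fderiv ℝ a q (Y q)) : ℂ).im) := by
  have h1 := h.along_θ_sub hX hY hq
  rw [along_eq_zero h.isOpen X hθY hq, along_eq_zero h.isOpen Y hθX hq] at h1
  linarith

/-- Both sides are half of `dθ (u, v)`, as `along_θ_sub` shows on constant fields. -/
lemma im_inner_eq (h : IsLocalModel Ω θ J T a s) (h' : IsLocalModel Ω θ J T' b r) {q : E}
    (hq : q ∈ Ω) (u v : E) :
    (inner ℂ (fderiv ℝ a q u) (fderiv ℝ a q v) : ℂ).im
      = (inner ℂ (fderiv ℝ b q u) (fderiv ℝ b q v) : ℂ).im := by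
  have h1 := h.along_θ_sub (X := fun _ => u) (Y := fun _ => v) contDiffOn_const contDiffOn_const hq
  have h2 := h'.along_θ_sub (X := fun _ => u) (Y := fun _ => v) contDiffOn_const contDiffOn_const hq
  linarith

/-- Replacing `v` by `J v` multiplies its image by `i` and so turns equality of imaginary parts into
equality of real parts. Only `v` has to be horizontal. -/
lemma inner_horizontal_eq (h : IsLocalModel Ω θ J T a s) (h' : IsLocalModel Ω θ J T' b r) {q : E}
    (hq : q ∈ Ω) (u v : E) (hv : θ q v = 0) :
    (inner ℂ (fderiv ℝ a q u) (fderiv ℝ a q v) : ℂ)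
      = inner ℂ (fderiv ℝ b q u) (fderiv ℝ b q v) := by
  refine Complex.ext ?_ (h.im_inner_eq h' hq u v)
  have h1 := h.im_inner_eq h' hq u (J q v)
  rw [h.fderiv_J q hq v hv, h'.fderiv_J q hq v hv, inner_smul_right, inner_smul_right] at h1
  simpa using h1

lemma smooth_θ (h : IsLocalModel Ω θ J T a s) : ContDiffOn ℝ ∞ θ Ω := by
  refine contDiffOn_clm_apply.2 fun u => ?_
  have hu : ContDiffOn ℝ ∞ (fun _ : E => u) Ω := contDiffOn_const
  have hi : ContDiffOn ℝ ∞ (fun q => (inner ℂ (a q) (along (fun _ => u) a q) : ℂ)) Ω :=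
    h.smooth_fst.inner ℂ (contDiffOn_along h.isOpen hu h.smooth_fst)
  exact ((contDiffOn_along h.isOpen hu h.smooth_snd).add
    (Complex.imCLM.contDiff.comp_contDiffOn hi)).congr fun q hq => h.θ_eq q hq u

/-- The nondegenerate bilinear form `dθ / 2 + θ ⊗ θ`. -/
def leviBilin (θ : E →L[ℝ] ℝ) (A : E →L[ℝ] V) : E →L[ℝ] E →L[ℝ] ℝ :=
  LinearMap.toContinuousLinearMap
    ((LinearMap.toContinuousLinearMap : (E →ₗ[ℝ] ℝ) ≃ₗ[ℝ] (E →L[ℝ] ℝ)).toLinearMap ∘ₗ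
      LinearMap.mk₂ ℝ (fun u v => (inner ℂ (A u) (A v) : ℂ).im + θ u * θ v)
        (fun _ _ _ => by simp only [map_add, inner_add_left, Complex.add_im]; ring)
        (fun _ _ _ => by
          simp only [map_smul, ← Complex.coe_smul, inner_smul_left, Complex.conj_ofReal,
            Complex.im_ofReal_mul, smul_eq_mul]; ring)
        (fun _ _ _ => by simp only [map_add, inner_add_right, Complex.add_im]; ring)
        (fun _ _ _ => by
          simp only [map_smul, ← Complex.coe_smul, inner_smul_right,
            Complex.im_ofReal_mul, smul_eq_mul]; ring))

lemma leviBilin_apply (θ : E →L[ℝ] ℝ) (A : E →L[ℝ] V) (u v : E) :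
    leviBilin θ A u v = (inner ℂ (A u) (A v) : ℂ).im + θ u * θ v := rfl

lemma smooth_leviBilin (h : IsLocalModel Ω θ J T a s) :
    ContDiffOn ℝ ∞ (fun q => leviBilin (θ q) (fderiv ℝ a q)) Ω := by
  refine contDiffOn_clm_apply.2 fun u => contDiffOn_clm_apply.2 fun v => ?_
  have hc : ∀ u, ContDiffOn ℝ ∞ (fun q => along (fun _ => u) a q) Ω := fun u =>
    contDiffOn_along h.isOpen contDiffOn_const h.smooth_fst
  have hi : ContDiffOn ℝ ∞
      (fun q => (inner ℂ (along (fun _ => u) a q) (along (fun _ => v) a q) : ℂ)) Ω :=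
    (hc u).inner ℂ (hc v)
  exact (Complex.imCLM.contDiff.comp_contDiffOn hi).add
    ((h.smooth_θ.clm_apply contDiffOn_const).mul (h.smooth_θ.clm_apply contDiffOn_const))

/-- Pairing with `T` gives `θ u = 0`; pairing with `J u` then gives `‖da u‖² = 0`. -/
lemma eq_zero_of_leviBilin (h : IsLocalModel Ω θ J T a s) {q : E} (hq : q ∈ Ω) {u : E}
    (hu : ∀ v, leviBilin (θ q) (fderiv ℝ a q) u v = 0) : u = 0 := by
  have hA := h.adapted q hq
  have h0 : θ q u = 0 := by
    have := hu (T q)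
    rw [leviBilin_apply, ← inner_conj_symm, hA.inner_reeb, hA.θ_reeb, Complex.conj_im,
      ← Complex.ofReal_mul, Complex.ofReal_im] at this
    linarith
  refine hA.injective u h0 ?_
  have h1 := hu (J q u)
  rw [leviBilin_apply, h0, h.fderiv_J q hq u h0, inner_smul_right, inner_self_eq_norm_sq_to_K] at h1
  have h2 : ‖fderiv ℝ a q u‖ ^ 2 = 0 := by
    have h3 : (Complex.I * ((‖fderiv ℝ a q u‖ : ℂ)) ^ 2).im = ‖fderiv ℝ a q u‖ ^ 2 := by
      rw [← Complex.ofReal_pow, Complex.im_mul_ofReal]; simp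
    rw [← h3]
    simpa using h1
  exact norm_eq_zero.1 (pow_eq_zero_iff two_ne_zero |>.1 h2)

lemma injective_leviBilin (h : IsLocalModel Ω θ J T a s) {q : E} (hq : q ∈ Ω) :
    Function.Injective (leviBilin (θ q) (fderiv ℝ a q)) := by
  rw [injective_iff_map_eq_zero]
  exact fun u hu => h.eq_zero_of_leviBilin hq fun v => by rw [hu]; rfl

lemma finrank_dual : Module.finrank ℝ E = Module.finrank ℝ (E →L[ℝ] ℝ) := by
  rw [← (LinearMap.toContinuousLinearMap : (E →ₗ[ℝ] ℝ) ≃ₗ[ℝ] (E →L[ℝ] ℝ)).finrank_eq]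
  exact (Subspace.dual_finrank_eq (K := ℝ) (V := E)).symm

/-- This characterizes `T` by `θ` and `dθ` alone: the vector defined by orthogonality in the ambient
space is the intrinsic Reeb vector. -/
lemma leviBilin_reeb (h : IsLocalModel Ω θ J T a s) {q : E} (hq : q ∈ Ω) :
    leviBilin (θ q) (fderiv ℝ a q) (T q) = θ q := by
  ext v
  have hA := h.adapted q hq
  rw [leviBilin_apply, hA.inner_reeb, hA.θ_reeb, ← Complex.ofReal_mul, Complex.ofReal_im]
  ring

lemma reeb_eq (h : IsLocalModel Ω θ J T a s) (h' : IsLocalModel Ω θ J T' b r) {q : E}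
    (hq : q ∈ Ω) : T' q = T q := by
  refine h.injective_leviBilin hq ?_
  rw [h.leviBilin_reeb hq]
  conv_rhs => rw [← h'.leviBilin_reeb hq]
  ext v
  rw [leviBilin_apply, leviBilin_apply, h.im_inner_eq h' hq]

/-- `T` is only given pointwise; it is smooth as the solution of a nondegenerate linear equation
with smooth data. -/
lemma smooth_reeb (h : IsLocalModel Ω θ J T a s) : ContDiffOn ℝ ∞ T Ω :=
  contDiffOn_of_solution finrank_dual h.smooth_leviBilin (fun _ hq => h.injective_leviBilin hq)
    (h.smooth_θ.congr fun _ hq => h.leviBilin_reeb hq)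

/-- The same device: `J X` solves a `leviBilin` equation whose right-hand side involves only `i X
a`. -/
lemma smooth_J (h : IsLocalModel Ω θ J T a s) {X : E → E} (hX : ContDiffOn ℝ ∞ X Ω)
    (hθX : ∀ q ∈ Ω, θ q (X q) = 0) : ContDiffOn ℝ ∞ (fun q => J q (X q)) Ω := by
  refine contDiffOn_of_solution finrank_dual h.smooth_leviBilin
    (fun _ hq => h.injective_leviBilin hq) (contDiffOn_clm_apply.2 fun v => ?_)
  have hi : ContDiffOn ℝ ∞
      (fun q => (inner ℂ (Complex.I • along X a q) (along (fun _ => v) a q) : ℂ)) Ω :=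
    ((contDiffOn_along h.isOpen hX h.smooth_fst).const_smul Complex.I).inner ℂ
      (contDiffOn_along h.isOpen contDiffOn_const h.smooth_fst)
  refine (Complex.imCLM.contDiff.comp_contDiffOn hi).congr fun q hq => ?_
  rw [leviBilin_apply, h.θ_J q hq _ (hθX q hq), zero_mul, add_zero, h.fderiv_J q hq _ (hθX q hq)]
  rfl

/-- Every horizontal vector extends to a smooth horizontal vector field. -/
lemma exists_horizontal (h : IsLocalModel Ω θ J T a s) {p u : E}
    (hu : θ p u = 0) : ∃ X : E → E, ContDiffOn ℝ ∞ X Ω ∧ (∀ q ∈ Ω, θ q (X q) = 0) ∧ X p = u := by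
  refine ⟨fun q => u - θ q u • T q, contDiffOn_const.sub
    ((h.smooth_θ.clm_apply contDiffOn_const).smul h.smooth_reeb), fun q hq => ?_, by simp [hu]⟩
  rw [map_sub, map_smul, (h.adapted q hq).θ_reeb, smul_eq_mul, mul_one, sub_self]

lemma exists_horizontal_ne_zero (h : IsLocalModel Ω θ J T a s) (hd : 2 ≤ Module.finrank ℝ E)
    (p : E) :
    ∃ X : E → E, ContDiffOn ℝ ∞ X Ω ∧ (∀ q ∈ Ω, θ q (X q) = 0) ∧ X p ≠ 0 := by
  have hker : (θ p).toLinearMap.ker ≠ ⊥ := fun hk => by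
    have h1 := LinearMap.finrank_range_of_inj (LinearMap.ker_eq_bot.1 hk)
    have h2 := Submodule.finrank_le (LinearMap.range (θ p).toLinearMap)
    rw [Module.finrank_self] at h2
    omega
  obtain ⟨u, hu, hne⟩ := Submodule.exists_mem_ne_zero_of_ne_bot hker
  obtain ⟨X, h1, h2, h3⟩ := h.exists_horizontal (p := p) (u := u) hu
  exact ⟨X, h1, h2, h3 ▸ hne⟩

/-- The value is `-2 ‖da X‖²`, and `da` is injective on `ker θ`. -/
lemma θ_lieBracket_J_ne_zero (h : IsLocalModel Ω θ J T a s) {X : E → E} (hX : ContDiffOn ℝ ∞ X Ω)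
    (hθX : ∀ q ∈ Ω, θ q (X q) = 0) {p : E} (hp : p ∈ Ω) (hne : X p ≠ 0) :
    θ p (VectorField.lieBracket ℝ X (fun q => J q (X q)) p) ≠ 0 := by
  rw [h.θ_lieBracket hX (h.smooth_J hX hθX) hθX (fun q hq => h.θ_J q hq _ (hθX q hq)) hp]
  intro h0
  refine hne (h.eq_zero_of_leviBilin hp fun v => ?_)
  have h1 : fderiv ℝ a p (X p) = 0 := by
    rw [h.fderiv_J p hp _ (hθX p hp), inner_smul_right, inner_self_eq_norm_sq_to_K] at h0
    have h3 : (Complex.I * ((‖fderiv ℝ a p (X p)‖ : ℂ)) ^ 2).im = ‖fderiv ℝ a p (X p)‖ ^ 2 := by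
      rw [← Complex.ofReal_pow, Complex.im_mul_ofReal]; simp
    have h4 : ‖fderiv ℝ a p (X p)‖ ^ 2 = 0 := by
      rw [← h3]
      simpa using h0
    exact norm_eq_zero.1 (pow_eq_zero_iff two_ne_zero |>.1 h4)
  rw [leviBilin_apply, h1, hθX p hp]
  simp

/-- The length of the fundamental vector field is determined by the induced structure. -/
theorem norm_reeb_eq (h : IsLocalModel Ω θ J T a s) (h' : IsLocalModel Ω θ J T b r)
    (hd : 2 ≤ Module.finrank ℝ E) {p : E} (hp : p ∈ Ω) :
    ‖fderiv ℝ a p (T p)‖ ^ 2 = ‖fderiv ℝ b p (T p)‖ ^ 2 := by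
  have hΩ := h.isOpen
  obtain ⟨X, hX, hθX, hne⟩ := h.exists_horizontal_ne_zero hd p
  have hY := h.smooth_J hX hθX
  set Y : E → E := fun q => J q (X q) with hYdef
  set G : E → V × V := fun q => (a q, b q) with hGdef
  have hG : ContDiffOn ℝ ∞ G Ω := h.smooth_fst.prodMk h'.smooth_fst
  have hfG : ∀ q ∈ Ω, ∀ u, fderiv ℝ G q u = (fderiv ℝ a q u, fderiv ℝ b q u) := fun q hq u => by
    have := ((differentiableAt_of_smooth hΩ h.smooth_fst hq).hasFDerivAt.prodMk
      (differentiableAt_of_smooth hΩ h'.smooth_fst hq).hasFDerivAt).fderiv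
    exact DFunLike.congr_fun this u
  have hXY : ∀ q ∈ Ω, along Y G q = Complex.I • along X G q := fun q hq => by
    rw [along, along, hfG q hq, hfG q hq, hYdef, h.fderiv_J q hq _ (hθX q hq),
      h'.fderiv_J q hq _ (hθX q hq)]
    rfl
  set δ : E → ℝ := fun q => ‖fderiv ℝ a q (T q)‖ ^ 2 - ‖fderiv ℝ b q (T q)‖ ^ 2 with hδdef
  have hδ : ∀ q ∈ Ω, ∀ u v,
      diffInner (fderiv ℝ G q u) (fderiv ℝ G q v) = θ q u * θ q v * δ q := by
    intro q hq u v
    have hA := h.adapted q hq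
    have hB := h'.adapted q hq
    -- The horizontal part of `v` contributes equally to both hermitian products, so only the `T`
    -- component of `v` is left.
    have hv : v = (v - θ q v • T q) + θ q v • T q := by abel
    have hv0 : θ q (v - θ q v • T q) = 0 := by simp [hA.θ_reeb]
    have e : ∀ A : E →L[ℝ] V, IsAdapted (θ q) A (T q) →
        (inner ℂ (A u) (A v) : ℂ) = inner ℂ (A u) (A (v - θ q v • T q))
          + θ q u * θ q v * ((‖A (T q)‖ ^ 2 : ℝ) : ℂ) := fun A hA => by
      conv_lhs => rw [hv, map_add, inner_add_right, map_smul, ← Complex.coe_smul,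
        inner_smul_right, ← inner_conj_symm (A u) (A (T q)), hA.inner_reeb]
      simp only [map_mul, Complex.conj_ofReal]
      ring
    rw [hfG q hq, hfG q hq, diffInner]
    simp only
    rw [e _ hA, e _ hB, h.inner_horizontal_eq h' hq u _ hv0, hδdef]
    push_cast
    ring
  have h1 := diffInner_along_along_self hΩ hG hδ hX hY hXY hθX hp
  have h2 : ∀ u, diffInner (along X (along X G) p - Complex.I • along Y (along X G) p)
      (fderiv ℝ G p u) = 0 := fun u =>
    diffInner_along_along_horizontal hΩ hG hδ hX hY hXY hθX (R := fun _ => u) contDiffOn_const hp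
  have hκ := h.θ_lieBracket_J_ne_zero hX hθX hp hne
  set κ := θ p (VectorField.lieBracket ℝ X Y p)
  obtain ⟨k, hk⟩ := (h.adapted p hp).exists_inner_self_sub (h'.adapted p hp)
    (fun x y _ hy => h.inner_horizontal_eq h' hp x y hy) (fun u => by
      have := h2 u
      rw [hfG p hp, diffInner, sub_eq_zero] at this
      exact this)
  rw [← diffInner, h1] at hk
  have hk' : 2 * κ ^ 2 * δ p * (‖fderiv ℝ a p (T p)‖ ^ 2 * ‖fderiv ℝ b p (T p)‖ ^ 2)
      = k ^ 2 * (‖fderiv ℝ b p (T p)‖ ^ 2 - ‖fderiv ℝ a p (T p)‖ ^ 2) := by exact_mod_cast hk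
  have hva : 0 < ‖fderiv ℝ a p (T p)‖ := norm_pos_iff.2 (h.adapted p hp).reeb_ne_zero
  have hvb : 0 < ‖fderiv ℝ b p (T p)‖ := norm_pos_iff.2 (h'.adapted p hp).reeb_ne_zero
  -- The two evaluations of `⟨Z, Z⟩` multiply `δ` by numbers of opposite sign, so collecting them
  -- leaves a strictly positive factor times `δ`.
  have hpos : 0 < 2 * κ ^ 2 * (‖fderiv ℝ a p (T p)‖ ^ 2 * ‖fderiv ℝ b p (T p)‖ ^ 2) + k ^ 2 := by
    positivity
  have h0 : (2 * κ ^ 2 * (‖fderiv ℝ a p (T p)‖ ^ 2 * ‖fderiv ℝ b p (T p)‖ ^ 2) + k ^ 2) * δ p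
      = 0 := by
    rw [hδdef] at hk' ⊢
    linear_combination hk'
  exact sub_eq_zero.1 ((mul_eq_zero.1 h0).resolve_left hpos.ne')

end IsLocalModel

end Local

/-! ### Rigidity: the unitary frame transition is locally constant -/

section Local

variable {E : Type*} [NormedAddCommGroup E] [NormedSpace ℝ E] [FiniteDimensional ℝ E]
  {V : Type*} [NormedAddCommGroup V] [InnerProductSpace ℂ V] [FiniteDimensional ℂ V]
  {Ω : Set E} {θ : E → E →L[ℝ] ℝ} {J : E → E → E} {T : E → E} {a b : E → V} {s r : E → ℝ}

lemma along_clm_apply {F₁ F₂ : Type*} [NormedAddCommGroup F₁] [NormedSpace ℝ F₁]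
    [NormedAddCommGroup F₂] [NormedSpace ℝ F₂] (hΩ : IsOpen Ω) (X : E → E)
    {U : E → F₁ →L[ℝ] F₂} {f : E → F₁} (hU : ContDiffOn ℝ ∞ U Ω) (hf : ContDiffOn ℝ ∞ f Ω) {q : E}
    (hq : q ∈ Ω) :
    along X (fun q => U q (f q)) q = along X U q (f q) + U q (along X f q) := by
  rw [along, fderiv_clm_apply (differentiableAt_of_smooth hΩ hU hq)
    (differentiableAt_of_smooth hΩ hf hq)]
  exact add_comm _ _

lemma along_const (X : E → E) {F : Type*} [NormedAddCommGroup F] [NormedSpace ℝ F] (c : F)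
    (q : E) : along X (fun _ => c) q = 0 := by
  rw [along, fderiv_fun_const]
  rfl

lemma eq_of_hasFDerivAt_zero {F : Type*} [NormedAddCommGroup F] [NormedSpace ℝ F] {f : E → F}
    {p : E} {ε : ℝ} (hε : 0 < ε) (hf : ∀ q ∈ Metric.ball p ε, HasFDerivAt f (0 : E →L[ℝ] F) q)
    {q : E} (hq : q ∈ Metric.ball p ε) : f q = f p :=
  Metric.isOpen_ball.is_const_of_fderiv_eq_zero (convex_ball p ε).isPreconnected
    (fun q hq => (hf q hq).differentiableAt.differentiableWithinAt)
    (fun q hq => (hf q hq).fderiv) hq (Metric.mem_ball_self hε)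

/-- The real linear map of `V` carrying the adapted frame of `a` to that of `b`. -/
def frameTransition (T : E → E) (a b : E → V) (q : E) : V →L[ℝ] V :=
  (extendBy (fderiv ℝ b q) (Complex.I • fderiv ℝ b q (T q))).comp
    (extendBy (fderiv ℝ a q) (Complex.I • fderiv ℝ a q (T q))).inverse

namespace IsLocalModel

lemma smooth_extendBy (h : IsLocalModel Ω θ J T a s) :
    ContDiffOn ℝ ∞ (fun q => extendBy (fderiv ℝ a q) (Complex.I • fderiv ℝ a q (T q))) Ω := by
  refine contDiffOn_clm_apply.2 fun x => ?_
  have h1 : ContDiffOn ℝ ∞ (along (fun _ => x.1) a) Ω :=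
    contDiffOn_along h.isOpen contDiffOn_const h.smooth_fst
  have h2 : ContDiffOn ℝ ∞ (along T a) Ω := contDiffOn_along h.isOpen h.smooth_reeb h.smooth_fst
  refine (h1.add ((h2.const_smul Complex.I).const_smul x.2)).congr fun q _ => ?_
  rw [extendBy_apply]
  rfl

lemma isInvertible_extendBy (h : IsLocalModel Ω θ J T a s) {q : E} (hq : q ∈ Ω) :
    (extendBy (fderiv ℝ a q) (Complex.I • fderiv ℝ a q (T q))).IsInvertible := by
  have : FiniteDimensional ℝ V := FiniteDimensional.complexToReal V
  exact isInvertible_of_injective (h.adapted q hq).finrank_prod_eq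
    (h.adapted q hq).injective_extendBy

lemma smooth_frameTransition (h : IsLocalModel Ω θ J T a s) (h' : IsLocalModel Ω θ J T b r) :
    ContDiffOn ℝ ∞ (frameTransition T a b) Ω := by
  have : FiniteDimensional ℝ V := FiniteDimensional.complexToReal V
  rcases Ω.eq_empty_or_nonempty with rfl | ⟨p, hp⟩
  · exact contDiffOn_empty
  exact h'.smooth_extendBy.clm_comp (contDiffOn_inverse (h.adapted p hp).finrank_prod_eq
    h.smooth_extendBy fun q hq => (h.adapted q hq).injective_extendBy)

lemma frameTransition_extendBy (h : IsLocalModel Ω θ J T a s) {q : E} (hq : q ∈ Ω) (x : E × ℝ) :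
    frameTransition T a b q (extendBy (fderiv ℝ a q) (Complex.I • fderiv ℝ a q (T q)) x)
      = extendBy (fderiv ℝ b q) (Complex.I • fderiv ℝ b q (T q)) x := by
  rw [frameTransition, ContinuousLinearMap.comp_apply,
    (h.isInvertible_extendBy hq).inverse_apply_self]

lemma frameTransition_fderiv (h : IsLocalModel Ω θ J T a s) {q : E} (hq : q ∈ Ω) (u : E) :
    frameTransition T a b q (fderiv ℝ a q u) = fderiv ℝ b q u := by
  simpa [extendBy_apply] using h.frameTransition_extendBy (b := b) hq (u, 0)

lemma inner_frameTransition (h : IsLocalModel Ω θ J T a s) (h' : IsLocalModel Ω θ J T b r)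
    (hd : 2 ≤ Module.finrank ℝ E) {q : E} (hq : q ∈ Ω) (x y : V) :
    (inner ℂ (frameTransition T a b q x) (frameTransition T a b q y) : ℂ) = inner ℂ x y := by
  obtain ⟨x, rfl⟩ := (h.adapted q hq).surjective_extendBy x
  obtain ⟨y, rfl⟩ := (h.adapted q hq).surjective_extendBy y
  rw [h.frameTransition_extendBy hq, h.frameTransition_extendBy hq]
  exact (inner_extendBy ((h.adapted q hq).inner_eq (h'.adapted q hq)
    (fun x y _ hy => h.inner_horizontal_eq h' hq x y hy) (h.norm_reeb_eq h' hd hq)) x y).symm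

/-- Preserving the hermitian product forces complex linearity: the squared norm of the difference
expands to zero. -/
lemma frameTransition_smul (h : IsLocalModel Ω θ J T a s) (h' : IsLocalModel Ω θ J T b r)
    (hd : 2 ≤ Module.finrank ℝ E) {q : E} (hq : q ∈ Ω) (c : ℂ) (x : V) :
    frameTransition T a b q (c • x) = c • frameTransition T a b q x := by
  rw [← sub_eq_zero, ← inner_self_eq_zero (𝕜 := ℂ)]
  simp only [inner_sub_left, inner_sub_right, inner_smul_left, inner_smul_right,
    h.inner_frameTransition h' hd hq]
  ring

lemma along_frameTransition_smul (h : IsLocalModel Ω θ J T a s) (h' : IsLocalModel Ω θ J T b r)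
    (hd : 2 ≤ Module.finrank ℝ E) {q : E} (hq : q ∈ Ω) (X : E → E) (c : ℂ) (x : V) :
    along X (frameTransition T a b) q (c • x) = c • along X (frameTransition T a b) q x := by
  have hU := h.smooth_frameTransition h'
  have h1 := along_congr h.isOpen X (fun q hq => h.frameTransition_smul h' hd hq c x) hq
  rw [along_const_smul h.isOpen X (hU.clm_apply contDiffOn_const) _ hq,
    along_clm_apply h.isOpen X hU contDiffOn_const hq,
    along_clm_apply h.isOpen X hU contDiffOn_const hq] at h1
  simpa [along_const] using h1

lemma along_frameTransition_skew (h : IsLocalModel Ω θ J T a s) (h' : IsLocalModel Ω θ J T b r)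
    (hd : 2 ≤ Module.finrank ℝ E) {q : E} (hq : q ∈ Ω) (X : E → E) (x y : V) :
    (inner ℂ (along X (frameTransition T a b) q x) (frameTransition T a b q y) : ℂ)
      + inner ℂ (frameTransition T a b q x) (along X (frameTransition T a b) q y) = 0 := by
  have hU := h.smooth_frameTransition h'
  have h1 := along_congr h.isOpen X (fun q hq => h.inner_frameTransition h' hd hq x y) hq
  rw [along_inner h.isOpen X (hU.clm_apply contDiffOn_const) (hU.clm_apply contDiffOn_const) hq,
    along_clm_apply h.isOpen X hU contDiffOn_const hq,
    along_clm_apply h.isOpen X hU contDiffOn_const hq] at h1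
  simpa [along_const] using h1

/-- Differentiate `U (da w) = db w` along `u`; second derivatives of `a` and `b` are symmetric. -/
lemma fderiv_frameTransition_symm (h : IsLocalModel Ω θ J T a s) (h' : IsLocalModel Ω θ J T b r)
    {q : E} (hq : q ∈ Ω) (u w : E) :
    fderiv ℝ (frameTransition T a b) q u (fderiv ℝ a q w)
      = fderiv ℝ (frameTransition T a b) q w (fderiv ℝ a q u) := by
  have hU := h.smooth_frameTransition h'
  have hΩ := h.isOpen
  have key : ∀ u w, along (fun _ => u) (frameTransition T a b) q (fderiv ℝ a q w)
      + frameTransition T a b q (along (fun _ => u) (along (fun _ => w) a) q)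
        = along (fun _ => u) (along (fun _ => w) b) q := fun u w => by
    refine Eq.trans ?_
      (along_congr hΩ (fun _ => u) (fun q hq => h.frameTransition_fderiv (b := b) hq w) hq)
    exact (along_clm_apply hΩ _ hU (contDiffOn_along hΩ contDiffOn_const h.smooth_fst) hq).symm
  have hc : ∀ f : E → V, ContDiffOn ℝ ∞ f Ω →
      along (fun _ => u) (along (fun _ => w) f) q = along (fun _ => w) (along (fun _ => u) f) q :=
    fun f hf => by
      rw [← sub_eq_zero, along_sub_along hΩ contDiffOn_const contDiffOn_const hf hq]
      simp [VectorField.lieBracket, along]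
  have h1 := key u w
  rw [hc a h.smooth_fst, hc b h'.smooth_fst, ← key w u] at h1
  exact add_right_cancel h1

/-- The argument for uniqueness of the Levi-Civita connection, with `K` the derivative of the
transition. -/
lemma fderiv_frameTransition_horizontal (h : IsLocalModel Ω θ J T a s)
    (h' : IsLocalModel Ω θ J T b r) (hd : 2 ≤ Module.finrank ℝ E) {q : E} (hq : q ∈ Ω) {u : E}
    (hu : θ q u = 0) : fderiv ℝ (frameTransition T a b) q u = 0 := by
  set K := fderiv ℝ (frameTransition T a b) q with hK
  set A := fderiv ℝ a q
  set B := fderiv ℝ b q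
  have hsymm : ∀ u w, K u (A w) = K w (A u) := h.fderiv_frameTransition_symm h' hq
  have hskew : ∀ w u v, (inner ℂ (K w (A u)) (B v) : ℂ).re
      = -(inner ℂ (K w (A v)) (B u) : ℂ).re := fun w u v => by
    have h1 := h.along_frameTransition_skew h' hd hq (fun _ => w) (A u) (A v)
    rw [h.frameTransition_fderiv hq, h.frameTransition_fderiv hq, ← inner_conj_symm (B u)] at h1
    have h2 := congrArg Complex.re h1
    rw [Complex.add_re, Complex.conj_re, Complex.zero_re] at h2
    exact eq_neg_of_add_eq_zero_left h2
  -- The trilinear form `Re ⟨K w (A u), B v⟩` is symmetric in `w, u` and skew in `u, v`, hence zero.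
  have hzero : ∀ w u v, (inner ℂ (K w (A u)) (B v) : ℂ).re = 0 := fun w u v => by
    have h1 := hskew w u v
    have h2 := hskew u v w
    have h3 := hskew v w u
    rw [hsymm w v] at h1
    rw [hsymm u w] at h2
    rw [hsymm v u] at h3
    linarith
  -- The `B v` span only a real hyperplane, so a vanishing real part is not enough. For horizontal
  -- `u`, using `J u` as well kills the imaginary part.
  have hhor : ∀ w, K w (A u) = 0 := fun w => by
    refine (h'.adapted q hq).eq_of_inner fun v => ?_
    rw [inner_zero_left]
    have h1 := hzero w (J q u) v
    rw [h.fderiv_J q hq u hu, hK, show (fderiv ℝ (frameTransition T a b) q w) (Complex.I • A u)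
      = Complex.I • K w (A u) from h.along_frameTransition_smul h' hd hq (fun _ => w) _ _,
      inner_smul_left] at h1
    exact Complex.ext (hzero w u v) (by simpa using h1)
  ext1 x
  obtain ⟨⟨y, t⟩, rfl⟩ := (h.adapted q hq).surjective_extendBy x
  -- Symmetry handles `K u` on the hyperplane `A E`; complex linearity handles the normal direction
  -- `i A T`.
  have h2 : K u (Complex.I • A (T q)) = Complex.I • K u (A (T q)) :=
    h.along_frameTransition_smul h' hd hq (fun _ => u) _ _
  rw [extendBy_apply, map_add, map_smul, h2, hsymm u, hsymm u, hhor, hhor]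
  simp

/-- Derivatives along `X` and `J X` vanish on all of `Ω`, hence so does the derivative along `[X, J
X]`, which is not horizontal. -/
lemma fderiv_frameTransition (h : IsLocalModel Ω θ J T a s)
    (h' : IsLocalModel Ω θ J T b r) (hd : 2 ≤ Module.finrank ℝ E) {q : E} (hq : q ∈ Ω) :
    fderiv ℝ (frameTransition T a b) q = 0 := by
  obtain ⟨X, hX, hθX, hne⟩ := h.exists_horizontal_ne_zero hd q
  have hY := h.smooth_J hX hθX
  have hκ := h.θ_lieBracket_J_ne_zero hX hθX hq hne
  have hU := h.smooth_frameTransition h'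
  have h1 := along_sub_along h.isOpen hX hY hU hq
  have hz : ∀ X : E → E, (∀ q ∈ Ω, θ q (X q) = 0) →
      ∀ q ∈ Ω, along X (frameTransition T a b) q = 0 :=
    fun X hX q hq => h.fderiv_frameTransition_horizontal h' hd hq (hX q hq)
  rw [along_eq_zero h.isOpen X (hz _ fun q hq => h.θ_J q hq _ (hθX q hq)) hq,
    along_eq_zero h.isOpen _ (hz _ hθX) hq, sub_zero] at h1
  set R := VectorField.lieBracket ℝ X (fun q => J q (X q)) q with hR
  have hθT := (h.adapted q hq).θ_reeb
  have hdec : ∀ v, θ q (v - θ q v • T q) = 0 := fun v => by simp [hθT]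
  have h2 : fderiv ℝ (frameTransition T a b) q (T q) = 0 := by
    have h3 := h.fderiv_frameTransition_horizontal h' hd hq (hdec R)
    rw [map_sub, show fderiv ℝ (frameTransition T a b) q R = 0 from h1.symm, zero_sub, neg_eq_zero,
      map_smul] at h3
    exact (smul_eq_zero.1 h3).resolve_left hκ
  ext1 v
  have h4 := h.fderiv_frameTransition_horizontal h' hd hq (hdec v)
  rw [map_sub, map_smul, h2, smul_zero, sub_zero] at h4
  exact h4

/-- Two local models with the same contact form and complex structure differ, near each point, by
a unitary map followed by a left translation. -/
theorem exists_unitary (h : IsLocalModel Ω θ J T a s) (h' : IsLocalModel Ω θ J T b r)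
    (hd : 2 ≤ Module.finrank ℝ E) {p : E} (hp : p ∈ Ω) :
    ∃ (U : V ≃ₗᵢ[ℂ] V) (c : V) (k : ℝ), ∀ᶠ q in nhds p,
      b q = U (a q) + c ∧ r q = s q - (inner ℂ c (U (a q)) : ℂ).im + k := by
  obtain ⟨ε, hε, hball⟩ := Metric.isOpen_iff.1 h.isOpen p hp
  let U₀ : V →ₗ[ℂ] V :=
    { toFun := frameTransition T a b p
      map_add' := map_add _
      map_smul' := fun c x => h.frameTransition_smul h' hd hp c x }
  let U : V ≃ₗᵢ[ℂ] V := LinearIsometry.toLinearIsometryEquiv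
    (U₀.isometryOfInner fun x y => h.inner_frameTransition h' hd hp x y) rfl
  have hU : ∀ x, U x = frameTransition T a b p x := fun _ => rfl
  set W := frameTransition T a b p with hW
  have hconst : ∀ q ∈ Metric.ball p ε, frameTransition T a b q = W := fun q hq =>
    eq_of_hasFDerivAt_zero hε (fun q hq => by
      have hd' := differentiableAt_of_smooth h.isOpen (h.smooth_frameTransition h') (hball hq)
      rw [← h.fderiv_frameTransition h' hd (hball hq)]
      exact hd'.hasFDerivAt) hq
  have hWD : ∀ q ∈ Metric.ball p ε, ∀ u, W (fderiv ℝ a q u) = fderiv ℝ b q u := fun q hq u => by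
    rw [← hconst q hq, h.frameTransition_fderiv (hball hq)]
  have ha : ∀ q ∈ Metric.ball p ε, HasFDerivAt a (fderiv ℝ a q) q := fun q hq =>
    (differentiableAt_of_smooth h.isOpen h.smooth_fst (hball hq)).hasFDerivAt
  have hb : ∀ q ∈ Metric.ball p ε, HasFDerivAt b (fderiv ℝ b q) q := fun q hq =>
    (differentiableAt_of_smooth h.isOpen h'.smooth_fst (hball hq)).hasFDerivAt
  have hs : ∀ q ∈ Metric.ball p ε, HasFDerivAt s (fderiv ℝ s q) q := fun q hq =>
    (differentiableAt_of_smooth h.isOpen h.smooth_snd (hball hq)).hasFDerivAt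
  have hr : ∀ q ∈ Metric.ball p ε, HasFDerivAt r (fderiv ℝ r q) q := fun q hq =>
    (differentiableAt_of_smooth h.isOpen h'.smooth_snd (hball hq)).hasFDerivAt
  set c := b p - W (a p) with hc
  have hbc : ∀ q ∈ Metric.ball p ε, b q = W (a q) + c := fun q hq => by
    have := eq_of_hasFDerivAt_zero (f := fun q => b q - W (a q)) hε (fun q hq => by
      refine ((hb q hq).sub (W.hasFDerivAt.comp q (ha q hq))).congr_fderiv ?_
      ext u
      exact sub_eq_zero.2 (hWD q hq u).symm) hq
    rw [hc, ← this]
    abel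
  let ℓ : V →L[ℝ] ℝ := (Complex.imCLM.comp ((innerSL ℂ c).restrictScalars ℝ)).comp W
  have hℓ : ∀ x, ℓ x = (inner ℂ c (W x) : ℂ).im := fun _ => rfl
  refine ⟨U, c, r p - (s p - ℓ (a p)), Filter.eventually_of_mem (Metric.ball_mem_nhds p hε)
    fun q hq => ⟨hbc q hq, ?_⟩⟩
  -- Substituting `b = W a + c` in the two formulas for `θ` leaves `dr = ds - Im ⟨c, W da⟩`.
  have := eq_of_hasFDerivAt_zero (f := fun q => r q - (s q - ℓ (a q))) hε (fun q hq => by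
    refine ((hr q hq).sub ((hs q hq).sub (ℓ.hasFDerivAt.comp q (ha q hq)))).congr_fderiv ?_
    ext u
    have h1 := h.θ_eq q (hball hq) u
    rw [h'.θ_eq q (hball hq) u, hbc q hq, ← hWD q hq u, inner_add_left, Complex.add_im,
      h.inner_frameTransition h' hd hp] at h1
    change fderiv ℝ r q u - (fderiv ℝ s q u - ℓ (fderiv ℝ a q u)) = 0
    rw [hℓ]
    linarith) hq
  rw [← this, hU, ← hℓ]
  abel

end IsLocalModel

end Local

/-! ### Heisenberg rigid motions -/

namespace Heis

variable {n : ℕ}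

/-- A unitary map followed by a left translation of the Heisenberg group. -/
def rigidMap (U : EuclideanSpace ℂ (Fin n) ≃ₗᵢ[ℂ] EuclideanSpace ℂ (Fin n))
    (c : EuclideanSpace ℂ (Fin n)) (k : ℝ) (p : Heis n) : Heis n :=
  (U p.1 + c, p.2 - (inner ℂ c (U p.1) : ℂ).im + k)

/-- The differential of `rigidMap U c k`. -/
def rigidMapDeriv (U : EuclideanSpace ℂ (Fin n) ≃ₗᵢ[ℂ] EuclideanSpace ℂ (Fin n))
    (c : EuclideanSpace ℂ (Fin n)) : Heis n →L[ℝ] Heis n :=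
  let W : EuclideanSpace ℂ (Fin n) →L[ℝ] EuclideanSpace ℂ (Fin n) :=
    (U.toContinuousLinearEquiv : _ →L[ℂ] _).restrictScalars ℝ
  (W.comp (ContinuousLinearMap.fst ℝ _ ℝ)).prod (ContinuousLinearMap.snd ℝ _ ℝ -
    ((imInner c).comp W).comp (ContinuousLinearMap.fst ℝ _ ℝ))

variable (U : EuclideanSpace ℂ (Fin n) ≃ₗᵢ[ℂ] EuclideanSpace ℂ (Fin n))
    (c : EuclideanSpace ℂ (Fin n)) (k : ℝ)

lemma rigidMapDeriv_apply (v : Heis n) :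
    rigidMapDeriv U c v = (U v.1, v.2 - (inner ℂ c (U v.1) : ℂ).im) := rfl

lemma contDiff_rigidMap : ContDiff ℝ ∞ (rigidMap U c k) :=
  (rigidMapDeriv U c).contDiff.add (contDiff_const (c := ((c, k) : Heis n)))

lemma fderiv_rigidMap (p : Heis n) : fderiv ℝ (rigidMap U c k) p = rigidMapDeriv U c :=
  ((rigidMapDeriv U c).hasFDerivAt.add_const (c, k)).fderiv

/-- `rigidMap U c k` as a diffeomorphism. -/
def rigidMotion : Heis n ≃ₘ^∞⟮𝓘(ℝ, Heis n), 𝓘(ℝ, Heis n)⟯ Heis n where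
  toFun := rigidMap U c k
  invFun := rigidMap U.symm (-(U.symm c)) (-k)
  left_inv p := by
    simp only [rigidMap, map_add, LinearIsometryEquiv.symm_apply_apply, add_neg_cancel_right,
      inner_neg_left, inner_add_right, Complex.neg_im, Complex.add_im, inner_self_eq_norm_sq_to_K,
      LinearIsometryEquiv.inner_map_eq_flip]
    ext1
    · rfl
    · simp [← Complex.ofReal_pow]
      ring
  right_inv p := by
    simp only [rigidMap, map_add, map_neg, LinearIsometryEquiv.apply_symm_apply,
      neg_add_cancel_right, inner_neg_left, inner_add_right, inner_neg_right, Complex.neg_im,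
      Complex.add_im, inner_self_eq_norm_sq_to_K, LinearIsometryEquiv.inner_map_map]
    ext1
    · rfl
    · simp [← Complex.ofReal_pow]
      ring
  contMDiff_toFun := (contDiff_rigidMap U c k).contMDiff
  contMDiff_invFun := (contDiff_rigidMap U.symm (-(U.symm c)) (-k)).contMDiff

/-- The term `Im ⟨c, U v⟩` created by the translation cancels the shear in the `t` coordinate.
Compatibility with `J` then follows from complex linearity of `U`, since a vector is determined by
its `z` part and its contact form. -/
lemma isPseudohermitianTransformation_rigidMotion :
    IsPseudohermitianTransformation (pseudohermitian n) (pseudohermitian n) (rigidMotion U c k) := by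
  have hd : ∀ p v : Heis n, mfderiv 𝓘(ℝ, Heis n) 𝓘(ℝ, Heis n) (rigidMotion U c k) p v
      = rigidMapDeriv U c v := fun p v => by
    rw [mfderiv_eq_fderiv]
    exact DFunLike.congr_fun (fderiv_rigidMap U c k p) v
  have hθ : ∀ p v : Heis n,
      contactForm (rigidMap U c k p) (rigidMapDeriv U c v) = contactForm p v := fun p v => by
    rw [contactForm_apply, contactForm_apply, rigidMapDeriv_apply, rigidMap]
    simp only [inner_add_left, Complex.add_im, LinearIsometryEquiv.inner_map_map]
    ring
  refine ⟨fun p v => (congrArg (contactForm (rigidMap U c k p)) (hd p v)).trans (hθ p v),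
    fun p v _ => ?_⟩
  refine (hd p _).trans (Eq.trans ?_
    (congrArg (complexStructure (rigidMap U c k p)) (hd p v)).symm)
  refine ext_contactForm (p := rigidMap U c k p) ?_ ?_
  · change U (Complex.I • (v : Heis n).1) = Complex.I • U (v : Heis n).1
    rw [map_smul]
  · rw [contactForm_J]
    exact (hθ p _).trans (contactForm_J p v)

end Heis

/-! ### Submanifolds in charts -/

section Charts

variable {E : Type*} [NormedAddCommGroup E] [NormedSpace ℝ E]
  {M : Type*} [TopologicalSpace M] [ChartedSpace E M] [IsManifold 𝓘(ℝ, E) ∞ M] {n : ℕ}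
  {P : PseudohermitianStructure 𝓘(ℝ, E) M} {f g : M → Heis n}

/-- The differential of a map to the Heisenberg group, with values in the model space. -/
def heisDeriv (f : M → Heis n) (x : M) : TangentSpace 𝓘(ℝ, E) x →L[ℝ] Heis n :=
  mfderiv 𝓘(ℝ, E) 𝓘(ℝ, Heis n) f x

lemma IsPseudohermitianSubmanifold.θ_eq_heisDeriv (hf : IsPseudohermitianSubmanifold P f) (x : M)
    (v : TangentSpace 𝓘(ℝ, E) x) : P.θ x v = Heis.contactForm (f x) (heisDeriv f x v) :=
  hf.θ_eq x v

lemma IsPseudohermitianSubmanifold.heisDeriv_J (hf : IsPseudohermitianSubmanifold P f) (x : M)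
    (v : TangentSpace 𝓘(ℝ, E) x) (hv : P.θ x v = 0) :
    heisDeriv f x (P.J x v) = Heis.complexStructure (f x) (heisDeriv f x v) :=
  hf.J_eq x v hv

lemma IsPseudohermitianSubmanifold.injective_heisDeriv (hf : IsPseudohermitianSubmanifold P f)
    (x : M) : Function.Injective (heisDeriv (E := E) f x) :=
  hf.immersion x

/-- The differential of the inverse of a chart. -/
def chartFrame (x₀ : M) (q : E) : E →L[ℝ] TangentSpace 𝓘(ℝ, E) ((extChartAt 𝓘(ℝ, E) x₀).symm q) :=
  mfderivWithin 𝓘(ℝ, E) 𝓘(ℝ, E) (extChartAt 𝓘(ℝ, E) x₀).symm (Set.range 𝓘(ℝ, E)) q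

lemma isInvertible_chartFrame {x₀ : M} {q : E} (hq : q ∈ (extChartAt 𝓘(ℝ, E) x₀).target) :
    (chartFrame x₀ q).IsInvertible :=
  isInvertible_mfderivWithin_extChartAt_symm hq

lemma contDiffOn_chart (hf : ContMDiff 𝓘(ℝ, E) 𝓘(ℝ, Heis n) ∞ f) (x₀ : M) :
    ContDiffOn ℝ ∞ (fun q => f ((extChartAt 𝓘(ℝ, E) x₀).symm q)) (extChartAt 𝓘(ℝ, E) x₀).target :=
  contMDiffOn_iff_contDiffOn.1 (hf.comp_contMDiffOn (contMDiffOn_extChartAt_symm x₀))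

lemma fderiv_chart (hf : ContMDiff 𝓘(ℝ, E) 𝓘(ℝ, Heis n) ∞ f) {x₀ : M} {q : E}
    (hq : q ∈ (extChartAt 𝓘(ℝ, E) x₀).target) (u : E) :
    fderiv ℝ (fun q => f ((extChartAt 𝓘(ℝ, E) x₀).symm q)) q u
      = heisDeriv f ((extChartAt 𝓘(ℝ, E) x₀).symm q) (chartFrame x₀ q u) := by
  have h := mfderiv_comp_mfderivWithin (I := 𝓘(ℝ, E)) (I' := 𝓘(ℝ, E)) (I'' := 𝓘(ℝ, Heis n)) q
    (g := f) (f := (extChartAt 𝓘(ℝ, E) x₀).symm) (s := Set.range 𝓘(ℝ, E))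
    ((hf _).mdifferentiableAt (by simp)) (mdifferentiableWithinAt_extChartAt_symm hq)
    (by simpa using uniqueMDiffWithinAt_univ 𝓘(ℝ, E))
  refine Eq.trans ?_ (DFunLike.congr_fun h u)
  rw [show Set.range 𝓘(ℝ, E) = Set.univ by simp, mfderivWithin_univ, mfderiv_eq_fderiv]
  rfl

/-- At `x` the vector `v` is the Reeb vector of `P`, and it has a nonzero horizontal component. -/
structure IsReebAt (P : PseudohermitianStructure 𝓘(ℝ, E) M) (f : M → Heis n) (x : M)
    (v : TangentSpace 𝓘(ℝ, E) x) : Prop where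
  θ_eq_one : P.θ x v = 1
  orthogonal : ∀ v', P.θ x v' = 0 → Heis.leviMetric (heisDeriv f x v) (heisDeriv f x v') = 0
  fst_ne_zero : (heisDeriv f x v).1 ≠ 0

/-- The vector is the tangent preimage of `T + w`; a horizontal `w ≠ 0` has a nonzero `z` part. -/
lemma IsFundamentalVectorAt.exists_isReebAt (hf : IsPseudohermitianSubmanifold P f) {x : M}
    {w : Heis n} (hw : IsFundamentalVectorAt P f x w) (hne : w ≠ 0) : ∃ v, IsReebAt P f x v := by
  obtain ⟨v, hv⟩ := hw.tangent
  have hv : heisDeriv f x v = Heis.reeb + w := hv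
  have hfst : (Heis.reeb + w).1 = w.1 := by simp [Heis.reeb]
  refine ⟨v, ?_, fun v' hv' => ?_, ?_⟩
  · rw [hf.θ_eq_heisDeriv, hv, map_add, hw.horizontal, Heis.contactForm_apply]
    simp [Heis.reeb]
  · have h1 : Heis.leviMetric w (heisDeriv f x v') = 0 := hw.orthogonal v' hv'
    rw [Heis.leviMetric] at h1 ⊢
    rw [hv, hfst, h1]
  · intro h0
    refine hne (Heis.ext_contactForm (p := f x) ?_ (by rw [hw.horizontal, map_zero]))
    rw [← hfst, ← hv, h0]
    rfl

/-- Since `ker θ` is `J`-invariant, real orthogonality to its image is already complex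
orthogonality. -/
lemma IsAdapted.mk_of_orthogonal {V : Type*} [NormedAddCommGroup V] [InnerProductSpace ℂ V]
    [FiniteDimensional ℝ E] [FiniteDimensional ℂ V] {θ : E →L[ℝ] ℝ} {A : E →L[ℝ] V} {T : E}
    {J : E → E} (hT : θ T = 1) (hJ : ∀ u, θ u = 0 → θ (J u) = 0)
    (hA : ∀ u, θ u = 0 → A (J u) = Complex.I • A u)
    (horth : ∀ u, θ u = 0 → (inner ℂ (A T) (A u) : ℂ).re = 0) (hne : A T ≠ 0)
    (hinj : ∀ u, θ u = 0 → A u = 0 → u = 0)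
    (hd : Module.finrank ℝ E + 1 = 2 * Module.finrank ℂ V) : IsAdapted θ A T := by
  refine ⟨hT, fun v => ?_, hne, hinj, hd⟩
  have h0 : ∀ u, θ u = 0 → (inner ℂ (A T) (A u) : ℂ) = 0 := fun u hu => by
    refine Complex.ext (horth u hu) ?_
    have h1 := horth _ (hJ u hu)
    rw [hA u hu, inner_smul_right] at h1
    simpa using h1
  have h1 := h0 (v - θ v • T) (by simp [hT])
  rw [map_sub, inner_sub_right, sub_eq_zero, map_smul, ← Complex.coe_smul, inner_smul_right,
    inner_self_eq_norm_sq_to_K] at h1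
  rw [h1]
  push_cast
  rfl

variable [FiniteDimensional ℝ E]

lemma IsPseudohermitianSubmanifold.isLocalModel (hf : IsPseudohermitianSubmanifold P f)
    (hd : Module.finrank ℝ E + 1 = 2 * n) {τ : ∀ x : M, TangentSpace 𝓘(ℝ, E) x}
    (hτ : ∀ x, IsReebAt P f x (τ x)) (x₀ : M) :
    IsLocalModel (extChartAt 𝓘(ℝ, E) x₀).target
      (fun q => (P.θ ((extChartAt 𝓘(ℝ, E) x₀).symm q)).comp (chartFrame x₀ q))
      (fun q u => (chartFrame x₀ q).inverse (P.J _ (chartFrame x₀ q u)))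
      (fun q => (chartFrame x₀ q).inverse (τ _))
      (fun q => (f ((extChartAt 𝓘(ℝ, E) x₀).symm q)).1)
      (fun q => (f ((extChartAt 𝓘(ℝ, E) x₀).symm q)).2) := by
  have hsm := contDiffOn_chart hf.smooth x₀
  have hop := isOpen_extChartAt_target (I := 𝓘(ℝ, E)) x₀
  have hfst : ∀ q ∈ (extChartAt 𝓘(ℝ, E) x₀).target, ∀ u,
      fderiv ℝ (fun q => (f ((extChartAt 𝓘(ℝ, E) x₀).symm q)).1) q u
        = (heisDeriv f _ (chartFrame x₀ q u)).1 :=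
    fun q hq u => by
      rw [(differentiableAt_of_smooth hop hsm hq).hasFDerivAt.fst.fderiv]
      exact congrArg Prod.fst (fderiv_chart hf.smooth hq u)
  have hsnd : ∀ q ∈ (extChartAt 𝓘(ℝ, E) x₀).target, ∀ u,
      fderiv ℝ (fun q => (f ((extChartAt 𝓘(ℝ, E) x₀).symm q)).2) q u
        = (heisDeriv f _ (chartFrame x₀ q u)).2 :=
    fun q hq u => by
      rw [(differentiableAt_of_smooth hop hsm hq).hasFDerivAt.snd.fderiv]
      exact congrArg Prod.snd (fderiv_chart hf.smooth hq u)
  have hinv : ∀ q ∈ (extChartAt 𝓘(ℝ, E) x₀).target, ∀ v,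
      chartFrame x₀ q ((chartFrame x₀ q).inverse v) = v := fun q hq v =>
    (isInvertible_chartFrame hq).self_apply_inverse v
  have hθJ : ∀ q ∈ (extChartAt 𝓘(ℝ, E) x₀).target, ∀ u, P.θ _ (chartFrame x₀ q u) = 0 →
      P.θ _ (chartFrame x₀ q ((chartFrame x₀ q).inverse (P.J _ (chartFrame x₀ q u)))) = 0 :=
    fun q hq u hu => by
      rw [hinv q hq]
      exact P.θ_J _ _ hu
  have hfJ : ∀ q ∈ (extChartAt 𝓘(ℝ, E) x₀).target, ∀ u, P.θ _ (chartFrame x₀ q u) = 0 →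
      fderiv ℝ (fun q => (f ((extChartAt 𝓘(ℝ, E) x₀).symm q)).1) q
          ((chartFrame x₀ q).inverse (P.J _ (chartFrame x₀ q u)))
        = Complex.I • fderiv ℝ (fun q => (f ((extChartAt 𝓘(ℝ, E) x₀).symm q)).1) q u :=
    fun q hq u hu => by
      rw [hfst q hq, hfst q hq, hinv q hq]
      exact congrArg Prod.fst (hf.heisDeriv_J _ _ hu)
  refine ⟨hop, hsm.fst, hsm.snd, fun q hq u => ?_, hθJ, hfJ, fun q hq => ?_⟩
  · rw [hfst q hq, hsnd q hq]
    exact hf.θ_eq_heisDeriv _ _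
  · refine IsAdapted.mk_of_orthogonal ?_ (hθJ q hq) (hfJ q hq) (fun u hu => ?_) ?_
      (fun u hu h0 => ?_) (by simpa using hd)
    · rw [ContinuousLinearMap.comp_apply, hinv q hq]
      exact (hτ _).θ_eq_one
    · rw [hfst q hq, hfst q hq, hinv q hq]
      exact (hτ _).orthogonal _ hu
    · rw [hfst q hq, hinv q hq]
      exact (hτ _).fst_ne_zero
    · rw [hfst q hq] at h0
      refine (isInvertible_chartFrame hq).injective ?_
      rw [map_zero]
      refine hf.injective_heisDeriv _ ?_
      rw [map_zero]
      refine Heis.ext_contactForm (p := f ((extChartAt 𝓘(ℝ, E) x₀).symm q)) h0 ?_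
      rw [map_zero]
      exact (hf.θ_eq_heisDeriv _ _).symm.trans hu

end Charts

/-! ### From germs of rigid motions to a global one -/

section Germs

variable {E : Type*} [NormedAddCommGroup E] [NormedSpace ℝ E] [FiniteDimensional ℝ E] {n : ℕ}

/-- Lets two models share one Reeb field, as the comparison theorems require. -/
lemma IsLocalModel.congr_reeb {V : Type*} [NormedAddCommGroup V] [InnerProductSpace ℂ V]
    [FiniteDimensional ℂ V] {Ω : Set E} {θ : E → E →L[ℝ] ℝ} {J : E → E → E} {T T' : E → E}
    {a b : E → V} {s r : E → ℝ} (h : IsLocalModel Ω θ J T a s) (h' : IsLocalModel Ω θ J T' b r) :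
    IsLocalModel Ω θ J T b r :=
  { h' with adapted := fun q hq => h.reeb_eq h' hq ▸ h'.adapted q hq }

/-- A unitary map and a translation are determined by the germ of their composition with a local
model. -/
lemma IsLocalModel.unitary_unique {V : Type*} [NormedAddCommGroup V] [InnerProductSpace ℂ V]
    [FiniteDimensional ℂ V] {Ω : Set E} {θ : E → E →L[ℝ] ℝ} {J : E → E → E} {T : E → E}
    {a : E → V} {s : E → ℝ} (h : IsLocalModel Ω θ J T a s) {p : E} (hp : p ∈ Ω)
    {U U' : V ≃ₗᵢ[ℂ] V} {c c' : V} (he : ∀ᶠ q in nhds p, U (a q) + c = U' (a q) + c') :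
    U = U' ∧ c = c' := by
  have ha := (differentiableAt_of_smooth h.isOpen h.smooth_fst hp).hasFDerivAt
  have hd : ∀ W : V ≃ₗᵢ[ℂ] V, ∀ c : V, HasFDerivAt (fun q => W (a q) + c)
      (((W.toContinuousLinearEquiv : V →L[ℂ] V).restrictScalars ℝ).comp (fderiv ℝ a p)) p :=
    fun W c => (((W.toContinuousLinearEquiv : V →L[ℂ] V).restrictScalars ℝ).hasFDerivAt.comp p
      ha).add_const c
  have h1 := ((hd U c).congr_of_eventuallyEq (he.mono fun q hq => hq.symm)).unique (hd U' c')
  have h2 : ∀ u, U (fderiv ℝ a p u) = U' (fderiv ℝ a p u) := fun u => DFunLike.congr_fun h1 u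
  -- The image of the differential of `a` spans `V` over `ℂ`, so agreement on it suffices.
  have h3 : U = U' := by
    ext1 w
    obtain ⟨x, z, -, rfl⟩ := (h.adapted p hp).exists_eq_add w
    rw [map_add, map_add, map_smul, map_smul, h2, h2]
  subst h3
  exact ⟨rfl, add_left_cancel he.self_of_nhds⟩

variable {M : Type*} [TopologicalSpace M] [ChartedSpace E M] [IsManifold 𝓘(ℝ, E) ∞ M]
  {P : PseudohermitianStructure 𝓘(ℝ, E) M} {f g : M → Heis n}

lemma IsPseudohermitianSubmanifold.exists_rigidMap_germ (hf : IsPseudohermitianSubmanifold P f)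
    (hg : IsPseudohermitianSubmanifold P g) (hd : Module.finrank ℝ E + 1 = 2 * n)
    (hd' : 2 ≤ Module.finrank ℝ E) (hfR : ∀ x, ∃ v, IsReebAt P f x v)
    (hgR : ∀ x, ∃ v, IsReebAt P g x v) (x₀ : M) :
    ∃ U c k, ∀ᶠ x in nhds x₀, g x = Heis.rigidMap U c k (f x) := by
  choose τ hτ using hfR
  choose σ hσ using hgR
  have h := hf.isLocalModel hd hτ x₀
  have h' := h.congr_reeb (hg.isLocalModel hd hσ x₀)
  obtain ⟨U, c, k, hU⟩ := h.exists_unitary h' hd' (mem_extChartAt_target x₀)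
  refine ⟨U, c, k, ?_⟩
  filter_upwards [(continuousAt_extChartAt (I := 𝓘(ℝ, E)) x₀).eventually hU,
    extChartAt_source_mem_nhds (I := 𝓘(ℝ, E)) x₀] with x hx hxs
  rw [(extChartAt 𝓘(ℝ, E) x₀).left_inv hxs] at hx
  exact Prod.ext hx.1 hx.2

lemma IsPseudohermitianSubmanifold.rigidMap_germ_unique (hf : IsPseudohermitianSubmanifold P f)
    (hd : Module.finrank ℝ E + 1 = 2 * n) (hfR : ∀ x, ∃ v, IsReebAt P f x v) {x₀ : M}
    {U U' : EuclideanSpace ℂ (Fin n) ≃ₗᵢ[ℂ] EuclideanSpace ℂ (Fin n)}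
    {c c' : EuclideanSpace ℂ (Fin n)} {k k' : ℝ}
    (he : ∀ᶠ x in nhds x₀, Heis.rigidMap U c k (f x) = Heis.rigidMap U' c' k' (f x)) :
    Heis.rigidMap U c k = Heis.rigidMap U' c' k' := by
  choose τ hτ using hfR
  have h := hf.isLocalModel hd hτ x₀
  have h1 := (continuousAt_extChartAt_symm (I := 𝓘(ℝ, E)) x₀).eventually
    ((extChartAt_to_inv (I := 𝓘(ℝ, E)) x₀).symm ▸ he)
  obtain ⟨rfl, rfl⟩ := h.unitary_unique (mem_extChartAt_target x₀)
    (h1.mono fun q hq => congrArg Prod.fst hq)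
  have h2 := congrArg Prod.snd he.self_of_nhds
  rw [show k = k' from add_left_cancel h2]

theorem IsPseudohermitianSubmanifold.exists_rigidMap [PreconnectedSpace M] [Nonempty M]
    (hf : IsPseudohermitianSubmanifold P f)
    (hg : IsPseudohermitianSubmanifold P g) (hd : Module.finrank ℝ E + 1 = 2 * n)
    (hd' : 2 ≤ Module.finrank ℝ E) (hfR : ∀ x, ∃ v, IsReebAt P f x v)
    (hgR : ∀ x, ∃ v, IsReebAt P g x v) :
    ∃ U c k, ∀ x, g x = Heis.rigidMap U c k (f x) := by
  obtain ⟨x₀⟩ := ‹Nonempty M›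
  obtain ⟨U, c, k, h₀⟩ := hf.exists_rigidMap_germ hg hd hd' hfR hgR x₀
  refine ⟨U, c, k, fun x => ?_⟩
  set S : Set M := {x | ∀ᶠ y in nhds x, g y = Heis.rigidMap U c k (f y)}
  -- For closedness: a point `z` of `S` near `y` carries both the germ at `y` and the chosen motion,
  -- which therefore coincide, and `y` lies in `S`.
  have hclopen : IsClopen S := by
    refine ⟨⟨isOpen_iff_mem_nhds.2 fun y hy => ?_⟩, isOpen_iff_mem_nhds.2 fun y hy =>
      eventually_eventually_nhds.2 hy⟩
    obtain ⟨U', c', k', h'⟩ := hf.exists_rigidMap_germ hg hd hd' hfR hgR y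
    filter_upwards [eventually_eventually_nhds.2 h'] with z hz hzS
    have h1 := hf.rigidMap_germ_unique hd hfR (x₀ := z) (U := U') (U' := U) (c := c') (c' := c)
      (k := k') (k' := k) (by
        filter_upwards [hz, hzS] with w hw hw'
        rw [← hw, ← hw'])
    exact hy (h'.mono fun w hw => hw.trans (congrFun h1 (f w)))
  have hx : x ∈ S := hclopen.eq_univ ⟨x₀, h₀⟩ ▸ Set.mem_univ x
  exact hx.self_of_nhds

end Germs

/-! ### Pulling back submanifolds, and restricting rigid motions -/

section Transformations

variable {E : Type*} [NormedAddCommGroup E] [NormedSpace ℝ E] {n : ℕ}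
  {M : Type*} [TopologicalSpace M] [ChartedSpace E M] [IsManifold 𝓘(ℝ, E) ∞ M]
  {N : Type*} [TopologicalSpace N] [ChartedSpace E N] [IsManifold 𝓘(ℝ, E) ∞ N]
  {P : PseudohermitianStructure 𝓘(ℝ, E) M} {Q : PseudohermitianStructure 𝓘(ℝ, E) N}
  {f : M → Heis n} {g : N → Heis n} {φ : M ≃ₘ^∞⟮𝓘(ℝ, E), 𝓘(ℝ, E)⟯ N}

lemma heisDeriv_comp (hg : ContMDiff 𝓘(ℝ, E) 𝓘(ℝ, Heis n) ∞ g)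
    (φ : M ≃ₘ^∞⟮𝓘(ℝ, E), 𝓘(ℝ, E)⟯ N) (x : M) (v : TangentSpace 𝓘(ℝ, E) x) :
    heisDeriv (fun x => g (φ x)) x v
      = heisDeriv g (φ x) (mfderiv 𝓘(ℝ, E) 𝓘(ℝ, E) φ x v) := by
  have h := mfderiv_comp x (I := 𝓘(ℝ, E)) (I' := 𝓘(ℝ, E)) (I'' := 𝓘(ℝ, Heis n)) (g := g) (f := φ)
    ((hg _).mdifferentiableAt (by simp)) ((φ.contMDiff x).mdifferentiableAt (by simp))
  exact DFunLike.congr_fun h v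

lemma bijective_mfderiv_diffeomorph (φ : M ≃ₘ^∞⟮𝓘(ℝ, E), 𝓘(ℝ, E)⟯ N) (x : M) :
    Function.Bijective (mfderiv 𝓘(ℝ, E) 𝓘(ℝ, E) φ x) := by
  have h := (φ.mfderivToContinuousLinearEquiv (by simp) x).bijective
  exact h

/-- Places both immersions on the same `(M, P)`, where they can be compared. -/
lemma IsPseudohermitianSubmanifold.comp_transformation (hg : IsPseudohermitianSubmanifold Q g)
    (hφ : IsPseudohermitianTransformation P Q φ) :
    IsPseudohermitianSubmanifold P (fun x => g (φ x)) where
  smooth := hg.smooth.comp φ.contMDiff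
  immersion x := by
    change Function.Injective (heisDeriv (fun x => g (φ x)) x)
    intro v w h
    rw [heisDeriv_comp hg.smooth, heisDeriv_comp hg.smooth] at h
    exact (bijective_mfderiv_diffeomorph φ x).1 (hg.injective_heisDeriv _ h)
  θ_eq x v := by
    change _ = Heis.contactForm (g (φ x)) (heisDeriv (fun x => g (φ x)) x v)
    rw [heisDeriv_comp hg.smooth, ← hg.θ_eq_heisDeriv, hφ.θ_comp]
  J_eq x v hv := by
    change heisDeriv (fun x => g (φ x)) x (P.J x v)
      = Heis.complexStructure (g (φ x)) (heisDeriv (fun x => g (φ x)) x v)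
    rw [heisDeriv_comp hg.smooth, heisDeriv_comp hg.smooth, hφ.J_comp x v hv,
      hg.heisDeriv_J _ _ (by rw [hφ.θ_comp, hv])]

lemma IsReebAt.comp_transformation (hg : IsPseudohermitianSubmanifold Q g)
    (hφ : IsPseudohermitianTransformation P Q φ) {x : M}
    (h : ∃ v, IsReebAt Q g (φ x) v) : ∃ v, IsReebAt P (fun x => g (φ x)) x v := by
  obtain ⟨v, hv⟩ := h
  obtain ⟨u, rfl⟩ := (bijective_mfderiv_diffeomorph φ x).2 v
  refine ⟨u, by rw [← hφ.θ_comp]; exact hv.θ_eq_one, fun u' hu' => ?_, ?_⟩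
  · rw [heisDeriv_comp hg.smooth, heisDeriv_comp hg.smooth]
    exact hv.orthogonal _ (by rw [hφ.θ_comp, hu'])
  · rw [heisDeriv_comp hg.smooth]
    exact hv.fst_ne_zero

/-- A diffeomorphism that is the restriction of a rigid motion is a pseudohermitian
transformation. -/
lemma isPseudohermitianTransformation_of_rigid (hf : IsPseudohermitianSubmanifold P f)
    (hg : IsPseudohermitianSubmanifold Q g)
    {Φ : Heis n ≃ₘ^∞⟮𝓘(ℝ, Heis n), 𝓘(ℝ, Heis n)⟯ Heis n}
    (hΦ : IsPseudohermitianTransformation (Heis.pseudohermitian n) (Heis.pseudohermitian n) Φ)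
    (h : ∀ x, g (φ x) = Φ (f x)) : IsPseudohermitianTransformation P Q φ := by
  have hd : ∀ x v, heisDeriv g (φ x) (mfderiv 𝓘(ℝ, E) 𝓘(ℝ, E) φ x v)
      = fderiv ℝ Φ (f x) (heisDeriv f x v) := fun x v => by
    rw [← heisDeriv_comp hg.smooth, show (fun x => g (φ x)) = fun x => Φ (f x) from funext h]
    have h1 := mfderiv_comp x (I := 𝓘(ℝ, E)) (I' := 𝓘(ℝ, Heis n)) (I'' := 𝓘(ℝ, Heis n))
      (g := Φ) (f := f) ((Φ.contMDiff _).mdifferentiableAt (by simp))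
      ((hf.smooth x).mdifferentiableAt (by simp))
    rw [mfderiv_eq_fderiv (f := Φ)] at h1
    exact DFunLike.congr_fun h1 v
  have hΦθ : ∀ p v : Heis n, Heis.contactForm (Φ p) (fderiv ℝ Φ p v) = Heis.contactForm p v :=
    fun p v => by
      have h1 := hΦ.θ_comp p v
      rw [mfderiv_eq_fderiv] at h1
      exact h1
  have hΦJ : ∀ p v : Heis n, Heis.contactForm p v = 0 →
      fderiv ℝ Φ p (Heis.complexStructure p v)
        = Heis.complexStructure (Φ p) (fderiv ℝ Φ p v) := fun p v hv => by
    have h1 := hΦ.J_comp p v hv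
    rw [mfderiv_eq_fderiv] at h1
    exact h1
  have hθ : ∀ x v, Q.θ (φ x) (mfderiv 𝓘(ℝ, E) 𝓘(ℝ, E) φ x v) = P.θ x v := fun x v => by
    rw [hg.θ_eq_heisDeriv, hd, h, hΦθ, ← hf.θ_eq_heisDeriv]
  -- As `g` is an immersion, compatibility with `J` can be checked in the Heisenberg group.
  refine ⟨hθ, fun x v hv => hg.injective_heisDeriv _ ?_⟩
  rw [hd, hf.heisDeriv_J x v hv, hΦJ _ _ (by rw [← hf.θ_eq_heisDeriv, hv]),
    hg.heisDeriv_J _ _ (by rw [hθ, hv]), hd, h]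

end Transformations

end

theorem theoremD (m : ℕ) (hm : 1 ≤ m)
    {M : Type*} [TopologicalSpace M] [ChartedSpace (EuclideanSpace ℝ (Fin (2 * m + 1))) M]
    [IsManifold (𝓡 (2 * m + 1)) ∞ M] [SimplyConnectedSpace M]
    {N : Type*} [TopologicalSpace N] [ChartedSpace (EuclideanSpace ℝ (Fin (2 * m + 1))) N]
    [IsManifold (𝓡 (2 * m + 1)) ∞ N] [SimplyConnectedSpace N]
    (P : PseudohermitianStructure (𝓡 (2 * m + 1)) M)
    (Q : PseudohermitianStructure (𝓡 (2 * m + 1)) N)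
    (f : M → Heis (m + 1)) (hf : IsPseudohermitianSubmanifold P f)
    (g : N → Heis (m + 1)) (hg : IsPseudohermitianSubmanifold Q g)
    (hνM : ∀ x : M, hf.fundamentalVectorField x ≠ 0)
    (hνN : ∀ y : N, hg.fundamentalVectorField y ≠ 0)
    (φ : M ≃ₘ^∞⟮𝓡 (2 * m + 1), 𝓡 (2 * m + 1)⟯ N) :
    IsPseudohermitianTransformation P Q φ ↔
      ∃ Φ : Heis (m + 1) ≃ₘ^∞⟮𝓘(ℝ, Heis (m + 1)), 𝓘(ℝ, Heis (m + 1))⟯ Heis (m + 1),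
        IsPseudohermitianTransformation (Heis.pseudohermitian (m + 1))
          (Heis.pseudohermitian (m + 1)) Φ ∧
        ∀ x : M, g (φ x) = Φ (f x) := by
  constructor
  · intro hφ
    have hd : Module.finrank ℝ (EuclideanSpace ℝ (Fin (2 * m + 1))) = 2 * m + 1 := by simp
    have hfR : ∀ x, ∃ v, IsReebAt P f x v := fun x =>
      (hf.existsUnique_fundamentalVector x).choose_spec.1.exists_isReebAt hf (hνM x)
    have hgR : ∀ y, ∃ v, IsReebAt Q g y v := fun y =>
      (hg.existsUnique_fundamentalVector y).choose_spec.1.exists_isReebAt hg (hνN y)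
    -- The dimension `2m + 1` is that of a real hypersurface in `ℂ^(m+1)`; `m ≥ 1` provides nonzero
    -- horizontal vectors.
    obtain ⟨U, c, k, hU⟩ := hf.exists_rigidMap (hg.comp_transformation hφ)
      (by rw [hd]; ring) (by rw [hd]; omega) hfR
      (fun x => IsReebAt.comp_transformation hg hφ (hgR (φ x)))
    exact ⟨Heis.rigidMotion U c k, Heis.isPseudohermitianTransformation_rigidMotion U c k, hU⟩
  · rintro ⟨Φ, hΦ, h⟩
    exact isPseudohermitianTransformation_of_rigid hf hg hΦ h
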